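/- Let $n\ge 0$ and $[n]=\{1,\dots,n\}$. Encode a monotone lattice path with $n$ unit steps (north or east) from the origin by the set of indices of its north steps. For two such paths $U,L\subseteq[n]$ with $|U|=|L|$ such that $L$ never goes above $U$, the lattice path matroid $M[U,L]$ is the matroid on $[n]$ whose bases are the lattice paths with the same end points that stay between $L$ and $U$. A matroid $M'$ is a quotient of $M$ if there are a matroid $N$ and a subset $T$ of its ground set with $M=N\setminus T$ and $M'=N/T$. Let $\mathcal P_n$ be the set of all lattice path matroids on $[n]$, partially ordered by $M'\le M$ iff $M'$ is a quotient of $M$. For $M=M[U,L]$ with $U=\{u_1<\dots<u_k\}$ and $L=\{\ell_1<\dots<\ell_k\}$, the pair $(\ell_i,u_j)$ is a good pair of $M$ if $i\le j$ and $u_j-\ell_i\le j-i$. Let $\Lambda_n$ be the set $[n]\times[n]$ with the partial order in which $(\ell',u')\le(\ell,u)$ iff $\ell\le\ell'$ and $u\le u'$. **Theorem.** 1. For every cover $M[U',L']\lessdot M[U,L]$ in $\mathcal P_n$ one has $L'\subseteq L$, $U'\subseteq U$, $L\setminus L'=\{\ell\}$, $U\setminus U'=\{u\}$ for some $\ell,u$,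 and $(\ell,u)$ is a good pair of $M[U,L]$. Hence $\lambda(M[U',L']\lessdot M[U,L])=(\ell,u)$ defines an edge labeling of the Hasse diagram of $\mathcal P_n$ with labels in $\Lambda_n$ (the good pair labeling). 2. The good pair labeling $\lambda$ is an EL-labeling of $\mathcal P_n$: for all $x\le y$ in $\mathcal P_n$ there is exactly one maximal chain $C=(x=x_0\lessdot x_1\lessdot\dots\lessdot x_k=y)$ of $[x,y]$ whose label sequence $(\lambda(x_0\lessdot x_1),\dots,\lambda(x_{k-1}\lessdot x_k))$ is weakly increasing in $\Lambda_n$, and for every other maximal chain $C'$ of $[x,y]$ the label sequence of $C$ strictly precedes that of $C'$ lexicographically (at the first position where they differ, the label of $C$ is smaller in $\Lambda_n$). 3. The order complex of $\mathcal P_n$ (its faces are the chains of $\mathcal P_n$) is shellable, and so is the order complex of every interval $[x,y]$, $x\le y$, of $\mathcal P_n$. Here a finite simplicial complex is shellable if it is pure of some dimension $d$ and its facets can be ordered $F_1,\dots,F_t$ so that for each $1<j\le t$ the complex $(F_1\cup\dots\cup F_{j-1})\cap F_j$ is pure of dimension $d-1$. -/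

import Mathlib

/-! ## Quotients of (finite) matroids

Matroids with ground set `[n] = {1, …, n}` are modelled as matroids on the type `ℕ` with ground set
`Set.Icc 1 n`, so that there is always room for the extra elements of an extension. -/

/-- `M'` is a quotient of `M`: there are a finite matroid `N` and a subset `T` of its ground set with
`M = N \ T` (deletion) and `M' = N / T` (contraction). -/
def IsMatroidQuotient (M' M : Matroid ℕ) : Prop :=
  ∃ (N : Matroid ℕ) (T : Set ℕ), N.Finite ∧ T ⊆ N.E ∧ M = N.delete T ∧ M' = N.contract T

theorem IsMatroidQuotient.refl (M : Matroid ℕ) (hM : M.Finite) : IsMatroidQuotient M M :=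
  ⟨M, ∅, hM, by simp, by simp, by simp⟩

theorem IsMatroidQuotient.ground_eq {M' M : Matroid ℕ} (h : IsMatroidQuotient M' M) :
    M'.E = M.E := by
  obtain ⟨N, T, -, -, rfl, rfl⟩ := h
  simp

theorem IsMatroidQuotient.closure_subset {M' M : Matroid ℕ} (h : IsMatroidQuotient M' M)
    (X : Set ℕ) : M.closure X ⊆ M'.closure X := by
  obtain ⟨N, T, -, -, rfl, rfl⟩ := h
  rw [Matroid.delete_closure_eq, Matroid.contract_closure_eq]
  refine Set.sdiff_subset_sdiff_left (N.closure_subset_closure ?_)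
  exact Set.sdiff_subset.trans Set.subset_union_left

theorem indep_of_closure_subset {M' M : Matroid ℕ} (hE : M'.E = M.E)
    (hcl : ∀ X, M.closure X ⊆ M'.closure X) {I : Set ℕ} (hI : M'.Indep I) : M.Indep I := by
  rw [Matroid.indep_iff_forall_notMem_closure_sdiff (hE ▸ hI.subset_ground)]
  intro e he h
  exact hI.notMem_closure_sdiff_of_mem he (hcl _ h)

theorem isMatroidQuotient_of_closure_subset {M' M : Matroid ℕ} (hM : M.E.Finite)
    (hE : M'.E = M.E) (hcl : ∀ X, M.closure X ⊆ M'.closure X) : IsMatroidQuotient M' M := by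
  classical
  have hind : ∀ {I}, M'.Indep I → M.Indep I := fun h => indep_of_closure_subset hE hcl h
  have hfin : ∀ {I}, M.Indep I → I.Finite := fun h => hM.subset h.subset_ground
  have hfin' : ∀ {I}, M'.Indep I → I.Finite := fun h => hfin (hind h)
  obtain ⟨B', hB'⟩ := M'.exists_isBase
  obtain ⟨B₀, hB₀, hB'B₀⟩ := (hind hB'.indep).exists_isBase_superset
  have hcard : B'.ncard ≤ B₀.ncard := Set.ncard_le_ncard hB'B₀ (hfin hB₀.indep)
  obtain ⟨k, hk⟩ := Nat.exists_eq_add_of_le hcard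
  obtain ⟨T, hTE, hTk⟩ := hM.infinite_compl.exists_subset_card_eq k
  have hdisj : ∀ {x}, x ∈ M.E → x ∉ T := fun hx hT => hTE hT hx
  let Ind : Set ℕ → Prop := fun K => K ⊆ M.E ∪ T ∧ M.Indep (K ∩ M.E) ∧
    ∃ J ⊆ K, M'.Indep J ∧ K.ncard ≤ J.ncard + k
  have hEfin : (M.E ∪ (T : Set ℕ)).Finite := hM.union T.finite_toSet
  -- a maximal `M'`-independent subset of `K`
  have hbas : ∀ K : Set ℕ, K ⊆ M.E ∪ T → (∃ J ⊆ K, M'.Indep J ∧ K.ncard ≤ J.ncard + k) →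
      ∃ J, M'.IsBasis J (K ∩ M.E) ∧ K.ncard ≤ J.ncard + k := by
    rintro K hK ⟨J, hJK, hJ, hc⟩
    have hJE : J ⊆ K ∩ M.E := Set.subset_inter hJK (hE ▸ hJ.subset_ground)
    obtain ⟨J', hJ', hJJ'⟩ := hJ.subset_isBasis_of_subset hJE (by rw [hE]; exact Set.inter_subset_right)
    exact ⟨J', hJ', hc.trans (Nat.add_le_add_right (Set.ncard_le_ncard hJJ' (hfin' hJ'.indep)) k)⟩
  let NI : IndepMatroid ℕ := IndepMatroid.ofFinite hEfin Ind
    ⟨by simp, by simp, ∅, by simp, by simp, by simp⟩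
    (by
      rintro I K ⟨hKE, hK, hJ⟩ hIK
      obtain ⟨J, hJb, hc⟩ := hbas K hKE hJ
      refine ⟨hIK.trans hKE, hK.subset (Set.inter_subset_inter_left _ hIK), J ∩ I,
        Set.inter_subset_right, hJb.indep.subset Set.inter_subset_left, ?_⟩
      have hKf : K.Finite := hEfin.subset hKE
      have hJK : J ⊆ K := hJb.subset.trans Set.inter_subset_left
      have h1 := Set.ncard_sdiff_add_ncard_of_subset hIK hKf
      have h2 := Set.ncard_inter_add_ncard_sdiff_eq_ncard J I (hKf.subset hJK)
      have h3 : (J \ I).ncard ≤ (K \ I).ncard :=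
        Set.ncard_le_ncard (Set.sdiff_subset_sdiff_left hJK) (hKf.subset Set.sdiff_subset)
      omega)
    (by
      rintro I K ⟨hIE, hI, hIJ⟩ ⟨hKE, hK, hKJ⟩ hlt
      obtain ⟨J, hJ, hcJ⟩ := hbas I hIE hIJ
      obtain ⟨J2, hJ2, hcJ2⟩ := hbas K hKE hKJ
      have hIf : I.Finite := hEfin.subset hIE
      have hKf : K.Finite := hEfin.subset hKE
      have hJI : J ⊆ I := hJ.subset.trans Set.inter_subset_left
      rcases Nat.lt_or_ge I.ncard (J.ncard + k) with hc | hc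
      · by_cases hT : ∃ t ∈ K, t ∉ I ∧ t ∈ T
        · obtain ⟨t, htK, htI, htT⟩ := hT
          have htE : t ∉ M.E := fun h => hdisj h htT
          refine ⟨t, htK, htI, Set.insert_subset (Or.inr htT) hIE, ?_, J,
            hJI.trans (Set.subset_insert _ _), hJ.indep, ?_⟩
          · rwa [Set.insert_inter_of_notMem htE]
          · rw [Set.ncard_insert_of_notMem htI hIf]; omega
        · push Not at hT
          have h1 : (K \ M.E).ncard ≤ (I \ M.E).ncard := by
            refine Set.ncard_le_ncard ?_ (hIf.subset Set.sdiff_subset)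
            rintro t ⟨htK, htE⟩
            refine ⟨?_, htE⟩
            by_contra htI
            exact hT t htK htI ((hKE htK).resolve_left htE)
          have h2 := Set.ncard_inter_add_ncard_sdiff_eq_ncard K M.E hKf
          have h3 := Set.ncard_inter_add_ncard_sdiff_eq_ncard I M.E hIf
          have h4 : (I ∩ M.E).encard < (K ∩ M.E).encard := by
            rw [← (hIf.subset Set.inter_subset_left).cast_ncard_eq,
              ← (hKf.subset Set.inter_subset_left).cast_ncard_eq]
            exact_mod_cast (by omega)
          obtain ⟨e, he, hind2⟩ := hI.augment hK h4
          have heI : e ∉ I := fun h => he.2 ⟨h, he.1.2⟩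
          refine ⟨e, he.1.1, heI, Set.insert_subset (Or.inl he.1.2) hIE, ?_, J,
            hJI.trans (Set.subset_insert _ _), hJ.indep, ?_⟩
          · rwa [Set.insert_inter_of_mem he.1.2]
          · rw [Set.ncard_insert_of_notMem heI hIf]; omega
      · have h4 : J.encard < J2.encard := by
          rw [← (hfin' hJ.indep).cast_ncard_eq, ← (hfin' hJ2.indep).cast_ncard_eq]
          exact_mod_cast (by omega)
        obtain ⟨e, he, hind2⟩ := hJ.indep.augment hJ2.indep h4
        have heK := hJ2.subset he.1
        have hecl : e ∉ M'.closure (I ∩ M.E) := by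
          rw [← hJ.closure_eq_closure]
          exact ((hJ.indep.notMem_closure_iff (hE ▸ heK.2)).2 ⟨hind2, he.2⟩)
        have hecl2 : e ∉ M.closure (I ∩ M.E) := fun h => hecl (hcl _ h)
        have h5 := (hI.notMem_closure_iff heK.2).1 hecl2
        have heI : e ∉ I := fun h => h5.2 ⟨h, heK.2⟩
        refine ⟨e, heK.1, heI, Set.insert_subset (Or.inl heK.2) hIE, ?_, insert e J,
          Set.insert_subset_insert hJI, hind2, ?_⟩
        · rw [Set.insert_inter_of_mem heK.2]; exact h5.1
        · rw [Set.ncard_insert_of_notMem heI hIf,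
            Set.ncard_insert_of_notMem he.2 (hfin' hJ.indep)]; omega)
    (fun I h => h.1)
  let N : Matroid ℕ := NI.matroid
  have hNE : N.E = M.E ∪ T := rfl
  have hNI : ∀ K, N.Indep K ↔ Ind K := fun K => Iff.rfl
  have hTind : N.Indep T := by
    rw [hNI]
    refine ⟨Set.subset_union_right, ?_, ∅, by simp, by simp, by simp [hTk]⟩
    rw [Set.inter_comm, Set.disjoint_iff_inter_eq_empty.1 (Set.disjoint_left.2 fun x hx hT => hTE hT hx)]
    simp
  refine ⟨N, T, ⟨hEfin⟩, Set.subset_union_right, ?_, ?_⟩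
  · refine Matroid.ext_indep ?_ ?_
    · rw [Matroid.delete_ground, hNE, Set.union_sdiff_right, sdiff_eq_left.2]
      exact Set.disjoint_left.2 fun x hx hT => hTE hT hx
    · intro I hI
      rw [Matroid.delete_indep_iff, hNI]
      constructor
      · intro h
        refine ⟨⟨hI.trans Set.subset_union_left, h.subset Set.inter_subset_left, ?_⟩,
          Set.disjoint_left.2 fun x hx hT => hTE hT (hI hx)⟩
        obtain ⟨B, hB, hIB⟩ := h.exists_isBase_superset
        obtain ⟨J, hJ⟩ := M'.exists_isBasis I (by rw [hE]; exact hI)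
        obtain ⟨J2, hJ2, hJJ2⟩ := hJ.indep.subset_isBasis_of_subset (hJ.subset.trans hIB)
          (by rw [hE]; exact hB.subset_ground)
        have hJ2base : M'.IsBase J2 := by
          refine hJ2.indep.isBase_of_ground_subset_closure ?_
          rw [hJ2.closure_eq_closure, hE, ← hB.closure_eq]
          exact hcl B
        refine ⟨J, hJ.subset, hJ.indep, ?_⟩
        have hBf := hfin hB.indep
        have c1 : B.ncard = B₀.ncard := hB.ncard_eq_ncard_of_isBase hB₀
        have c2 : J2.ncard = B'.ncard := hJ2base.ncard_eq_ncard_of_isBase hB'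
        have c3 := Set.ncard_sdiff_add_ncard_of_subset hJJ2 (hfin' hJ2.indep)
        have c4 := Set.ncard_sdiff_add_ncard_of_subset hIB hBf
        have c5 : (J2 \ J).ncard ≤ (B \ I).ncard := by
          refine Set.ncard_le_ncard ?_ (hBf.subset Set.sdiff_subset)
          rintro x ⟨hx2, hxJ⟩
          refine ⟨hJ2.subset hx2, fun hxI => hxJ ?_⟩
          exact hJ.mem_of_insert_indep hxI (hJ2.indep.subset (Set.insert_subset hx2 hJJ2))
        omega
      · rintro ⟨⟨-, h, -⟩, -⟩
        rwa [Set.inter_eq_left.2 hI] at h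
  · refine Matroid.ext_indep ?_ ?_
    · rw [Matroid.contract_ground, hNE, Set.union_sdiff_right, sdiff_eq_left.2, hE]
      exact Set.disjoint_left.2 fun x hx hT => hTE hT hx
    · intro I hI
      rw [hE] at hI
      have hIT : Disjoint I (T : Set ℕ) := Set.disjoint_left.2 fun x hx hT => hTE hT (hI hx)
      have hIf : I.Finite := hM.subset hI
      have hIE : (I ∪ T) ∩ M.E = I := by
        ext x
        constructor
        · rintro ⟨hx | hx, hxE⟩
          · exact hx
          · exact absurd hxE (hTE hx)
        · exact fun hx => ⟨Or.inl hx, hI hx⟩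
      have hc : (I ∪ (T : Set ℕ)).ncard = I.ncard + k := by
        rw [Set.ncard_union_eq hIT hIf T.finite_toSet, Set.ncard_coe_finset, hTk]
      rw [hTind.contract_indep_iff, hNI]
      constructor
      · intro h
        refine ⟨hIT, Set.union_subset_union_left _ hI, ?_, I, Set.subset_union_left, h, hc.le⟩
        rw [hIE]; exact hind h
      · rintro ⟨-, -, -, J, hJ, hJi, hcJ⟩
        have hJI : J ⊆ I := by
          rw [← hIE]
          exact Set.subset_inter hJ (hE ▸ hJi.subset_ground)
        have : J = I := Set.eq_of_subset_of_ncard_le hJI (by omega) hIf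
        rwa [← this]

theorem IsMatroidQuotient.trans {M₁ M₂ M₃ : Matroid ℕ} (hM : M₃.E.Finite)
    (h₁ : IsMatroidQuotient M₁ M₂) (h₂ : IsMatroidQuotient M₂ M₃) : IsMatroidQuotient M₁ M₃ :=
  isMatroidQuotient_of_closure_subset hM (h₁.ground_eq.trans h₂.ground_eq)
    fun X => (h₂.closure_subset X).trans (h₁.closure_subset X)

theorem IsMatroidQuotient.antisymm {M₁ M₂ : Matroid ℕ}
    (h₁ : IsMatroidQuotient M₁ M₂) (h₂ : IsMatroidQuotient M₂ M₁) : M₁ = M₂ :=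
  Matroid.ext_closure fun X => (h₂.closure_subset X).antisymm (h₁.closure_subset X)

/-! ## Lattice path matroids -/

/-- A monotone lattice path with `n` unit steps from the origin is encoded by the set `A ⊆ [n]` of the
indices of its north steps. `northSteps A i` is the number of north steps among the first `i` steps,
that is, the height of the path after `i` steps. -/
def northSteps (A : Finset ℕ) (i : ℕ) : ℕ := (A.filter (· ≤ i)).card

/-- A lattice path matroid `M[U, L]` on `[n]`, given by its data: two lattice paths `U` (upper) and
`L` (lower) with `n` steps and the same end points, where `L` never goes above `U`. The matroid itself
is `LPM.toMatroid`, and it determines `U` and `L` by `LPM.toMatroid_injective`. -/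
@[ext]
structure LPM (n : ℕ) where
  /-- the set of north steps of the upper path -/
  U : Finset ℕ
  /-- the set of north steps of the lower path -/
  L : Finset ℕ
  U_subset : U ⊆ Finset.Icc 1 n
  L_subset : L ⊆ Finset.Icc 1 n
  card_eq : U.card = L.card
  noncrossing : ∀ i, northSteps L i ≤ northSteps U i

theorem northSteps_zero {A : Finset ℕ} {n : ℕ} (hA : A ⊆ Finset.Icc 1 n) : northSteps A 0 = 0 := by
  rw [northSteps, Finset.card_eq_zero, Finset.filter_eq_empty_iff]
  intro x hx h
  have := Finset.mem_Icc.1 (hA hx)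
  omega

theorem northSteps_of_le {A : Finset ℕ} {n : ℕ} (hA : A ⊆ Finset.Icc 1 n) :
    northSteps A n = A.card := by
  rw [northSteps, Finset.filter_true_of_mem]
  intro x hx
  exact (Finset.mem_Icc.1 (hA hx)).2

theorem northSteps_succ (A : Finset ℕ) (i : ℕ) :
    northSteps A (i + 1) = northSteps A i + if i + 1 ∈ A then 1 else 0 := by
  unfold northSteps
  split_ifs with h
  · have : A.filter (· ≤ i + 1) = insert (i + 1) (A.filter (· ≤ i)) := by
      ext x
      simp only [Finset.mem_filter, Finset.mem_insert]
      constructor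
      · rintro ⟨h1, h2⟩
        by_cases hx : x = i + 1
        · exact Or.inl hx
        · exact Or.inr ⟨h1, by omega⟩
      · rintro (rfl | ⟨h1, h2⟩)
        · exact ⟨h, le_rfl⟩
        · exact ⟨h1, by omega⟩
    rw [this, Finset.card_insert_of_notMem (by simp)]
  · rw [add_zero]
    congr 1
    refine Finset.filter_congr fun x hx => ⟨fun h2 => ?_, fun h2 => by omega⟩
    have : x ≠ i + 1 := fun h3 => h (h3 ▸ hx)
    omega

theorem northSteps_exchange {A : Finset ℕ} {x y : ℕ} (hx : x ∈ A) (hy : y ∉ A) (i : ℕ) :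
    northSteps (insert y (A.erase x)) i + (if x ≤ i then 1 else 0) =
      northSteps A i + if y ≤ i then 1 else 0 := by
  unfold northSteps
  simp only [Finset.card_filter]
  rw [Finset.sum_insert (by simp [hy]), ← Finset.add_sum_erase A _ hx]
  omega

theorem eq_of_northSteps_eq {A B : Finset ℕ} {n : ℕ} (hA : A ⊆ Finset.Icc 1 n)
    (hB : B ⊆ Finset.Icc 1 n) (h : ∀ i, northSteps A i = northSteps B i) : A = B := by
  ext x
  rcases x with _ | x
  · exact ⟨fun h0 => by simpa using hA h0, fun h0 => by simpa using hB h0⟩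
  · have h1 := northSteps_succ A x
    have h2 := northSteps_succ B x
    rw [h, h x] at h1
    by_cases hxA : x + 1 ∈ A <;> by_cases hxB : x + 1 ∈ B <;> simp_all

namespace LPM

variable {n : ℕ}

/-- The lattice path `A` (with `n` steps) has the same end points as `U` and `L` and stays between
them. -/
def IsPathBetween (M : LPM n) (A : Finset ℕ) : Prop :=
  A ⊆ Finset.Icc 1 n ∧ A.card = M.U.card ∧
    ∀ i, northSteps M.L i ≤ northSteps A i ∧ northSteps A i ≤ northSteps M.U i

theorem isPathBetween_U (M : LPM n) : M.IsPathBetween M.U :=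
  ⟨M.U_subset, rfl, fun i => ⟨M.noncrossing i, le_rfl⟩⟩

theorem isPathBetween_L (M : LPM n) : M.IsPathBetween M.L :=
  ⟨M.L_subset, M.card_eq.symm, fun i => ⟨le_rfl, M.noncrossing i⟩⟩

theorem IsPathBetween.exchange {M : LPM n} {A B : Finset ℕ} (hA : M.IsPathBetween A)
    (hB : M.IsPathBetween B) {x : ℕ} (hxA : x ∈ A) (hxB : x ∉ B) :
    ∃ y ∈ B, y ∉ A ∧ M.IsPathBetween (insert y (A.erase x)) := by
  obtain ⟨hAn, hAc, hAb⟩ := hA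
  obtain ⟨hBn, hBc, hBb⟩ := hB
  have hx := Finset.mem_Icc.1 (hAn hxA)
  suffices h : ∃ y ∈ B, y ∉ A ∧ (∀ i, x ≤ i → i < y → northSteps B i + 1 ≤ northSteps A i) ∧
      (∀ i, y ≤ i → i < x → northSteps A i + 1 ≤ northSteps B i) by
    obtain ⟨y, hyB, hyA, h1, h2⟩ := h
    refine ⟨y, hyB, hyA, ?_, ?_, fun i => ?_⟩
    · exact Finset.insert_subset (hBn hyB) ((Finset.erase_subset _ _).trans hAn)
    · rw [Finset.card_insert_of_notMem (by simp [hyA]), Finset.card_erase_add_one hxA, hAc]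
    · have h3 := northSteps_exchange hxA hyA i
      have h4 := hAb i
      have h5 := hBb i
      by_cases hxi : x ≤ i <;> by_cases hyi : y ≤ i
      · simp only [hxi, hyi, if_true] at h3; omega
      · have := h1 i hxi (by omega)
        simp only [hxi, hyi, if_true, if_false] at h3; omega
      · have := h2 i hyi (by omega)
        simp only [hxi, hyi, if_true, if_false] at h3; omega
      · simp only [hxi, hyi, if_false] at h3; omega
  obtain ⟨m, rfl⟩ : ∃ m, x = m + 1 := ⟨x - 1, by omega⟩
  have sA := northSteps_succ A m
  have sB := northSteps_succ B m
  simp only [hxA, hxB, if_true, if_false] at sA sB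
  rcases Nat.lt_or_ge (northSteps A m) (northSteps B m) with hm | hm
  · -- go to the left of `x`
    let P : ℕ → Prop := fun j => northSteps B j ≤ northSteps A j
    have hP0 : P 0 := by simp only [P, northSteps_zero hAn, northSteps_zero hBn, le_refl]
    classical
    set j := Nat.findGreatest P m with hj
    have hPj : P j := Nat.findGreatest_spec (Nat.zero_le m) hP0
    have hjm : j ≤ m := Nat.findGreatest_le m
    have hjm' : j ≠ m := by
      intro h
      rw [h] at hPj
      exact absurd hPj (not_le.2 hm)
    have hgt : ∀ i, j < i → i ≤ m → northSteps A i + 1 ≤ northSteps B i := fun i h1 h2 =>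
      not_le.1 (Nat.findGreatest_is_greatest (P := P) h1 h2)
    have h1 := hgt (j + 1) (by omega) (by omega)
    have tA := northSteps_succ A j
    have tB := northSteps_succ B j
    change northSteps B j ≤ northSteps A j at hPj
    have hjB : j + 1 ∈ B := by
      by_contra h
      simp only [h, if_false] at tB
      omega
    have hjA : j + 1 ∉ A := by
      intro h
      simp only [h, hjB, if_true] at tA tB
      omega
    exact ⟨j + 1, hjB, hjA, fun i h2 h3 => by omega, fun i h2 h3 => hgt i (by omega) (by omega)⟩
  · -- go to the right of `x`
    have hex : ∃ i, m + 1 ≤ i ∧ northSteps A i ≤ northSteps B i :=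
      ⟨n, hx.2, by rw [northSteps_of_le hAn, northSteps_of_le hBn, hAc, hBc]⟩
    classical
    set y := Nat.find hex with hy
    obtain ⟨hy1, hy2⟩ := Nat.find_spec hex
    have hmin : ∀ i, m + 1 ≤ i → i < y → northSteps B i + 1 ≤ northSteps A i := by
      intro i h1 h2
      have := Nat.find_min hex h2
      by_contra h3
      exact this ⟨h1, by omega⟩
    rw [← hy] at hy1 hy2
    have hne : y ≠ m + 1 := by
      intro h
      rw [h] at hy2
      omega
    obtain ⟨z, hz⟩ : ∃ z, y = z + 1 := ⟨y - 1, by omega⟩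
    have h1 := hmin z (by omega) (by omega)
    have tA := northSteps_succ A z
    have tB := northSteps_succ B z
    rw [hz] at hy2
    have hzB : z + 1 ∈ B := by
      by_contra h
      simp only [h, if_false] at tB
      omega
    have hzA : z + 1 ∉ A := by
      intro h
      simp only [h, hzB, if_true] at tA tB
      omega
    exact ⟨y, hz ▸ hzB, hz ▸ hzA, fun i h2 h3 => hmin i h2 h3, fun i h2 h3 => by omega⟩

/-- The matroid `M[U, L]` on the ground set `[n] = {1, …, n}`: its bases are (the sets of north steps
of) the lattice paths that stay between `U` and `L`. -/
def toMatroid (M : LPM n) : Matroid ℕ :=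
  Matroid.ofIsBaseOfFinite (E := Set.Icc 1 n) (Set.finite_Icc 1 n)
    (fun B => ∃ A : Finset ℕ, (A : Set ℕ) = B ∧ M.IsPathBetween A)
    ⟨M.U, M.U, rfl, M.isPathBetween_U⟩
    (by
      rintro X Y ⟨A, rfl, hA⟩ ⟨B, rfl, hB⟩ x ⟨hxA, hxB⟩
      obtain ⟨y, hyB, hyA, h⟩ := hA.exchange hB hxA hxB
      exact ⟨y, ⟨hyB, hyA⟩, insert y (A.erase x), by simp, h⟩)
    (by
      rintro B ⟨A, rfl, hA⟩
      exact fun x hx => Finset.mem_Icc.1 (hA.1 hx))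

theorem toMatroid_ground (M : LPM n) : M.toMatroid.E = Set.Icc 1 n := rfl

theorem toMatroid_finite (M : LPM n) : M.toMatroid.Finite := ⟨Set.finite_Icc 1 n⟩

theorem toMatroid_isBase_iff (M : LPM n) (A : Finset ℕ) :
    M.toMatroid.IsBase A ↔ M.IsPathBetween A := by
  change (∃ A' : Finset ℕ, (A' : Set ℕ) = A ∧ M.IsPathBetween A') ↔ _
  simp

theorem toMatroid_injective : Function.Injective (toMatroid : LPM n → Matroid ℕ) := by
  intro M M' h
  have key : ∀ A, M.IsPathBetween A ↔ M'.IsPathBetween A := fun A => by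
    rw [← toMatroid_isBase_iff, ← toMatroid_isBase_iff, h]
  have hU := (key _).1 M.isPathBetween_U
  have hU' := (key _).2 M'.isPathBetween_U
  have hL := (key _).1 M.isPathBetween_L
  have hL' := (key _).2 M'.isPathBetween_L
  refine LPM.ext ?_ ?_
  · exact eq_of_northSteps_eq M.U_subset M'.U_subset fun i => ((hU.2.2 i).2).antisymm (hU'.2.2 i).2
  · exact eq_of_northSteps_eq M.L_subset M'.L_subset fun i => ((hL'.2.2 i).1).antisymm (hL.2.2 i).1

/-- The poset `𝓟ₙ` of all lattice path matroids on `[n]`: `M' ≤ M` iff the matroid `M'` is a quotient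
of the matroid `M`. -/
instance : PartialOrder (LPM n) where
  le M' M := IsMatroidQuotient M'.toMatroid M.toMatroid
  le_refl M := IsMatroidQuotient.refl _ M.toMatroid_finite
  le_trans _ _ M h₁ h₂ := h₁.trans M.toMatroid_finite.ground_finite h₂
  le_antisymm _ _ h₁ h₂ := toMatroid_injective (h₁.antisymm h₂)

/-- `(ℓ, u)` is a good pair of `M[U, L]`, where `U = {u₁ < ⋯ < u_k}` and `L = {ℓ₁ < ⋯ < ℓ_k}`:
`ℓ = ℓᵢ` and `u = uⱼ` with `i ≤ j` and `uⱼ - ℓᵢ ≤ j - i`. The index of an element `ℓ` of `L` is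
the number of elements of `L` that are at most `ℓ`, and likewise for `U`. -/
def IsGoodPair (M : LPM n) (ℓ u : ℕ) : Prop :=
  ℓ ∈ M.L ∧ u ∈ M.U ∧ northSteps M.L ℓ ≤ northSteps M.U u ∧
    (u : ℤ) - ℓ ≤ (northSteps M.U u : ℤ) - northSteps M.L ℓ

end LPM

/-! ## Edge labelings, EL-labelings -/

/-- An edge labeling of the poset `P`: a label in `Λ` for each edge `x ⋖ y` of the Hasse diagram. -/
abbrev EdgeLabeling (P Λ : Type*) [PartialOrder P] := ∀ ⦃x y : P⦄, x ⋖ y → Λ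

/-- Saturated chains `x = x₀ ⋖ x₁ ⋖ ⋯ ⋖ x_k = y`, that is, the maximal chains of the interval
`[x, y]` (of a poset all of whose chains are finite). -/
inductive SaturatedChain {P : Type*} [PartialOrder P] : P → P → Type _
  | nil (x : P) : SaturatedChain x x
  | cons {x y z : P} (h : x ⋖ y) (C : SaturatedChain y z) : SaturatedChain x z

/-- The label sequence `(λ(x₀ ⋖ x₁), …, λ(x_{k-1} ⋖ x_k))` of a saturated chain. -/
def SaturatedChain.labels {P Λ : Type*} [PartialOrder P] (lam : EdgeLabeling P Λ) :
    {x y : P} → SaturatedChain x y → List Λ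
  | _, _, .nil _ => []
  | _, _, .cons h C => lam h :: C.labels lam

/-- The edge labeling `lam` is an EL-labeling: each interval `[x, y]` has a unique weakly increasing
maximal chain `C`, and `C` strictly precedes each other maximal chain of `[x, y]` in the
lexicographic order of the label sequences. -/
def IsELLabeling {P Λ : Type*} [PartialOrder P] [PartialOrder Λ] (lam : EdgeLabeling P Λ) : Prop :=
  ∀ x y : P, x ≤ y → ∃ C : SaturatedChain x y,
    (C.labels lam).Pairwise (· ≤ ·) ∧
    (∀ C' : SaturatedChain x y, (C'.labels lam).Pairwise (· ≤ ·) → C' = C) ∧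
    ∀ C' : SaturatedChain x y, C' ≠ C → List.Lex (· < ·) (C.labels lam) (C'.labels lam)

/-- The poset of labels: `[n] × [n]` with the opposite of the componentwise order, that is
`(ℓ', u') ≤ (ℓ, u)` iff `ℓ ≤ ℓ'` and `u ≤ u'`. -/
abbrev LabelPoset (n : ℕ) := (Set.Icc 1 n × Set.Icc 1 n)ᵒᵈ

/-- `lam` is the good pair labeling of `𝓟ₙ`: the label of each cover `M[U', L'] ⋖ M[U, L]` is
the pair `(L \ L', U \ U')`, where `L' ⊆ L` and `U' ⊆ U` each lack exactly one element, and this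
pair is a good pair of `M[U, L]`. These conditions determine `lam` uniquely. -/
def IsGoodPairLabeling {n : ℕ} (lam : EdgeLabeling (LPM n) (LabelPoset n)) : Prop :=
  ∀ ⦃M' M : LPM n⦄ (h : M' ⋖ M),
    M'.L ⊆ M.L ∧ M'.U ⊆ M.U ∧
    M.L \ M'.L = {((OrderDual.ofDual (lam h)).1 : ℕ)} ∧
    M.U \ M'.U = {((OrderDual.ofDual (lam h)).2 : ℕ)} ∧
    M.IsGoodPair (OrderDual.ofDual (lam h)).1 (OrderDual.ofDual (lam h)).2

/-! ## Order complexes and shellability -/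

/-- The order complex of `P`: the vertices are the elements of `P` and the faces are the
(nonempty) finite chains of `P`. -/
def orderComplex (P : Type*) [PartialOrder P] : AbstractSimplicialComplex P where
  faces := {s | s.Nonempty ∧ IsChain (· ≤ ·) (s : Set P)}
  isRelLowerSet_faces := fun _ hs =>
    ⟨hs.1, fun _ hts ht => ⟨ht, hs.2.mono (Finset.coe_subset.2 hts)⟩⟩
  singleton_mem v := ⟨Finset.singleton_nonempty v, by simp⟩

/-- A finite simplicial complex `K` is (pure) shellable: `K` is pure of some dimension `d`, and its
facets can be ordered as `F₁, …, F_t`, without repetition, such that for each `j > 1` the complex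
`(F₁ ∪ ⋯ ∪ F_{j-1}) ∩ F_j` is pure of dimension `d - 1`. The faces of this intersection (here with the
empty face, so that it is never void) are the subsets of `F_j` that lie in some `F_i` with `i < j`; a
face of dimension `d - 1` has `d` vertices. -/
def IsShellable {V : Type*} (K : AbstractSimplicialComplex V) : Prop :=
  K.faces.Finite ∧ ∃ (d t : ℕ) (F : Fin t → Finset V),
    Function.Injective F ∧
    (∀ s, s ∈ Set.range F ↔ Maximal (· ∈ K.faces) s) ∧
    (∀ j, (F j).card = d + 1) ∧
    ∀ j : Fin t, 0 < (j : ℕ) →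
      ∀ G : Finset V, Maximal (fun G => G ⊆ F j ∧ ∃ i < j, G ⊆ F i) G → G.card = d

/-! ## Heights of lattice paths -/

/-! Everything rests on a combinatorial description of the quotient order (`GoodPairsLE`): `M' ≤ M`
iff `L' ⊆ L`, `U' ⊆ U`, and the elements of `L \ L'` and `U \ U'`, matched in increasing order, form
good pairs of `M`.

For necessity, a quotient has larger closures. Closures of initial segments read off `U` and
closures of final segments read off `L`, which gives the inclusions. Spanning sets and independent
sets supported off or on an interval give two inequalities between heights (`northSteps_L_le_of_le`,
`northSteps_sub_le_of_le`), and these are the two conditions on a good pair. For sufficiency,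
deleting one good pair yields a quotient (`IsGoodPair.erase_le`, an exchange argument on paths), and
the largest missing pair can always be put back first (`GoodPairsLE.exists_add`), so induction on
the rank applies. In particular a cover adds exactly one good pair.

Along a maximal chain of `[x, y]` each element of `y.L \ x.L` and of `y.U \ x.U` is added once.
Since the label order is reversed, an increasing chain has to add the pair of the two maxima first.
That step exists, it determines the next element, and its label is strictly below the label of any
other first step; recursion gives the EL-property.

For shellability the partially ordered labels are replaced by the integer weights `-(ℓ + u)`, which
single out the same first steps. Maximal chains are sorted lexicographically by weight. A chain that
takes first steps locally takes them globally, so a chain that is preceded by another one can be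
improved by changing a single element where the two differ. -/

theorem northSteps_le_succ (A : Finset ℕ) (i : ℕ) :
    northSteps A i ≤ northSteps A (i + 1) ∧ northSteps A (i + 1) ≤ northSteps A i + 1 := by
  rw [northSteps_succ]
  split_ifs <;> omega

theorem northSteps_mono (A : Finset ℕ) : Monotone (northSteps A) :=
  monotone_nat_of_le_succ fun i => (northSteps_le_succ A i).1

theorem northSteps_le_add (A : Finset ℕ) {a b : ℕ} (h : a ≤ b) :
    northSteps A b ≤ northSteps A a + (b - a) := by
  induction b, h using Nat.le_induction with
  | base => omega
  | succ b hb ih =>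
    have := (northSteps_le_succ A b).2
    omega

theorem northSteps_of_ge {A : Finset ℕ} {n i : ℕ} (hA : A ⊆ Finset.Icc 1 n) (hi : n ≤ i) :
    northSteps A i = A.card :=
  northSteps_of_le (hA.trans (Finset.Icc_subset_Icc_right hi))

theorem northSteps_erase {A : Finset ℕ} {x : ℕ} (hx : x ∈ A) (i : ℕ) :
    northSteps (A.erase x) i + (if x ≤ i then 1 else 0) = northSteps A i := by
  unfold northSteps
  simp only [Finset.card_filter]
  rw [← Finset.add_sum_erase A _ hx]
  omega

theorem northSteps_insert {A : Finset ℕ} {x : ℕ} (hx : x ∉ A) (i : ℕ) :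
    northSteps (insert x A) i = northSteps A i + if x ≤ i then 1 else 0 := by
  have := northSteps_erase (Finset.mem_insert_self x A) i
  rw [Finset.erase_insert hx] at this
  exact this.symm

theorem northSteps_sdiff {A B : Finset ℕ} (h : B ⊆ A) (i : ℕ) :
    northSteps (A \ B) i + northSteps B i = northSteps A i := by
  unfold northSteps
  simp only [Finset.card_filter]
  exact Finset.sum_sdiff h

theorem northSteps_pred_of_mem {A : Finset ℕ} {x : ℕ} (hx : x ∈ A) (hx0 : 1 ≤ x) :
    northSteps A (x - 1) + 1 = northSteps A x := by
  obtain ⟨y, rfl⟩ : ∃ y, x = y + 1 := ⟨x - 1, by omega⟩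
  rw [northSteps_succ, if_pos hx]
  simp

theorem exists_mem_of_northSteps_lt {A : Finset ℕ} {a b : ℕ}
    (h : northSteps A a < northSteps A b) : ∃ x ∈ A, a < x ∧ x ≤ b := by
  by_contra! hc
  refine absurd h (not_lt.2 (Finset.card_le_card fun x hx => ?_))
  rw [Finset.mem_filter] at hx ⊢
  refine ⟨hx.1, ?_⟩
  by_contra hxa
  exact absurd hx.2 (not_le.2 (hc x hx.1 (not_le.1 hxa)))

theorem card_inter_Ioc (A : Finset ℕ) {a b : ℕ} (h : a ≤ b) :
    (A ∩ Finset.Ioc a b).card + northSteps A a = northSteps A b := by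
  unfold northSteps
  rw [← Finset.card_union_of_disjoint]
  · congr 1
    ext x
    simp only [Finset.mem_union, Finset.mem_inter, Finset.mem_Ioc, Finset.mem_filter]
    constructor
    · rintro (⟨h1, h2, h3⟩ | ⟨h1, h2⟩)
      · exact ⟨h1, h3⟩
      · exact ⟨h1, h2.trans h⟩
    · rintro ⟨h1, h2⟩
      rcases Nat.lt_or_ge a x with h3 | h3
      · exact Or.inl ⟨h1, h3, h2⟩
      · exact Or.inr ⟨h1, h3⟩
  · refine Finset.disjoint_left.2 fun x h1 h2 => ?_
    rw [Finset.mem_inter, Finset.mem_Ioc] at h1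
    rw [Finset.mem_filter] at h2
    omega

/-- A function with steps `0` and `1` is the height function of a lattice path. -/
theorem exists_path_of_heights (n : ℕ) (f : ℕ → ℕ) (h0 : f 0 = 0)
    (hf : ∀ i < n, f i ≤ f (i + 1) ∧ f (i + 1) ≤ f i + 1) :
    ∃ A ⊆ Finset.Icc 1 n, ∀ i ≤ n, northSteps A i = f i := by
  classical
  let A := (Finset.Icc 1 n).filter fun i => f (i - 1) < f i
  have hA : A ⊆ Finset.Icc 1 n := Finset.filter_subset _ _
  refine ⟨A, hA, fun i => ?_⟩
  induction i with
  | zero => intro; rw [northSteps_zero hA, h0]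
  | succ i ih =>
    intro hi
    have := hf i (by omega)
    rw [northSteps_succ, ih (by omega)]
    have hmem : i + 1 ∈ A ↔ f i < f (i + 1) := by
      simp only [A, Finset.mem_filter, Finset.mem_Icc, Nat.add_sub_cancel]
      exact ⟨fun h => h.2, fun h => ⟨by omega, h⟩⟩
    by_cases h : f i < f (i + 1)
    · rw [if_pos (hmem.2 h)]; omega
    · rw [if_neg (hmem.not.2 h)]; omega

/-- In use, `f` and `g` are heights of two paths, and `w` is their last contact before step `e`;
`exists_first_eq` provides the next contact. -/
theorem exists_last_eq (f g : ℕ → ℕ) (h0 : f 0 = g 0) {e : ℕ} (he : 1 ≤ e) :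
    ∃ w < e, f w = g w ∧ ∀ i, w < i → i < e → f i ≠ g i := by
  classical
  refine ⟨Nat.findGreatest (fun i => f i = g i) (e - 1), ?_, ?_, fun i h1 h2 => ?_⟩
  · have := Nat.findGreatest_le (P := fun i => f i = g i) (e - 1)
    omega
  · exact Nat.findGreatest_spec (P := fun i => f i = g i) (Nat.zero_le _) h0
  · exact Nat.findGreatest_is_greatest (P := fun i => f i = g i) h1 (by omega)

theorem exists_first_eq (f g : ℕ → ℕ) {e n : ℕ} (he : e ≤ n) (hn : f n = g n) :
    ∃ v, e ≤ v ∧ v ≤ n ∧ f v = g v ∧ ∀ i, e ≤ i → i < v → f i ≠ g i := by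
  classical
  have hex : ∃ v, e ≤ v ∧ f v = g v := ⟨n, he, hn⟩
  refine ⟨Nat.find hex, (Nat.find_spec hex).1, Nat.find_min' hex ⟨he, hn⟩,
    (Nat.find_spec hex).2, fun i h1 h2 h3 => Nat.find_min hex h2 ⟨h1, h3⟩⟩

/-! ### Paths between `L` and `U`, bases and independent sets -/

namespace LPM

variable {n : ℕ}

theorem card_U_eq (M : LPM n) {i : ℕ} (hi : n ≤ i) : northSteps M.U i = northSteps M.L i := by
  rw [northSteps_of_ge M.U_subset hi, northSteps_of_ge M.L_subset hi, M.card_eq]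

/-- `L` and `U` meet at step `n` and all heights are constant afterwards, so the bounds up to `n`
already force the end point of `A`. -/
theorem isPathBetween_iff (M : LPM n) (A : Finset ℕ) :
    M.IsPathBetween A ↔ A ⊆ Finset.Icc 1 n ∧
      ∀ i ≤ n, northSteps M.L i ≤ northSteps A i ∧ northSteps A i ≤ northSteps M.U i := by
  refine ⟨fun h => ⟨h.1, fun i _ => h.2.2 i⟩, fun ⟨h1, h2⟩ => ?_⟩
  have hn := h2 n le_rfl
  have hU := M.card_U_eq le_rfl
  have hc : northSteps A n = northSteps M.U n := by omega
  refine ⟨h1, ?_, fun i => ?_⟩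
  · rwa [northSteps_of_le h1, northSteps_of_le M.U_subset] at hc
  · rcases le_total i n with hi | hi
    · exact h2 i hi
    · have := M.card_U_eq hi
      rw [northSteps_of_ge M.U_subset hi] at this ⊢
      rw [northSteps_of_le M.U_subset] at hc
      rw [northSteps_of_ge h1 hi, ← northSteps_of_le h1, hc]
      omega

theorem IsPathBetween.northSteps_n {M : LPM n} {A : Finset ℕ} (hA : M.IsPathBetween A) :
    northSteps A n = northSteps M.U n := by
  rw [northSteps_of_le hA.1, northSteps_of_le M.U_subset, hA.2.1]

theorem exists_isPathBetween_of_isBase (M : LPM n) {B : Set ℕ} (hB : M.toMatroid.IsBase B) :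
    ∃ A : Finset ℕ, (A : Set ℕ) = B ∧ M.IsPathBetween A := hB

theorem exists_isPathBetween_of_indep (M : LPM n) {I : Set ℕ} (hI : M.toMatroid.Indep I) :
    ∃ A : Finset ℕ, I ⊆ A ∧ M.IsPathBetween A := by
  obtain ⟨B, hB, hIB⟩ := hI.exists_isBase_superset
  obtain ⟨A, rfl, hA⟩ := M.exists_isPathBetween_of_isBase hB
  exact ⟨A, hIB, hA⟩

theorem IsPathBetween.indep {M : LPM n} {A : Finset ℕ} (hA : M.IsPathBetween A) {I : Set ℕ}
    (hI : I ⊆ A) : M.toMatroid.Indep I :=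
  ((M.toMatroid_isBase_iff A).2 hA).indep.subset hI

/-! ## Removing a good pair gives a quotient -/

/-- Contacts of the path `B` with the boundary decide which exchanges are legal. Let `w` be the last
contact with `L` before `e` and `v` the first contact with `U` from `e` on: trading `f` for `e`
keeps `B` in `M` when `w < f ≤ v`. Let `q` be the last contact with `L` before `l` and `p` the first
contact with `U` from `u` on: `B` without `x` is a path of `M₁` when `q < x ≤ p`. It remains to
choose `x` so that the bounds of `M₁` at `w` and `v` force `w < f ≤ v`. -/
theorem IsGoodPair.exists_exchange {M M₁ : LPM n} {l u : ℕ} (hg : M.IsGoodPair l u)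
    (hU : M₁.U = M.U.erase u) (hL : M₁.L = M.L.erase l) {B : Finset ℕ} (hB : M.IsPathBetween B)
    {e : ℕ} (heB : e ∉ B) (he : e ∈ Finset.Icc 1 n) :
    ∃ x ∈ B, M₁.IsPathBetween (B.erase x) ∧ ∀ f ∈ B, f ≠ x →
      M₁.IsPathBetween (insert e ((B.erase x).erase f)) → M.IsPathBetween (insert e (B.erase f)) := by
  obtain ⟨hl, hu, hle, hsub⟩ := hg
  obtain ⟨hBn, -, hBb⟩ := id hB
  have hun := Finset.mem_Icc.1 (M.U_subset hu)
  have hln := Finset.mem_Icc.1 (M.L_subset hl)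
  have hen := Finset.mem_Icc.1 he
  have hBU : northSteps B n = northSteps M.U n := hB.northSteps_n
  have h0 : northSteps B 0 = northSteps M.L 0 := by
    rw [northSteps_zero hBn, northSteps_zero M.L_subset]
  obtain ⟨w, hwe, hw, hw'⟩ := exists_last_eq _ _ h0 hen.1
  obtain ⟨q, hql, hq, hq'⟩ := exists_last_eq _ _ h0 hln.1
  obtain ⟨v, hev, hvn, hv, hv'⟩ := exists_first_eq _ _ hen.2 hBU
  obtain ⟨p, hup, hpn, hp, hp'⟩ := exists_first_eq _ _ hun.2 hBU
  have mU := northSteps_mono M.U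
  have mL := northSteps_mono M.L
  have lpred := northSteps_pred_of_mem hl hln.1
  have upred := northSteps_pred_of_mem hu hun.1
  have hqL : northSteps M.L q ≤ northSteps M.L (l - 1) := mL (by omega)
  have hpU : northSteps M.U u ≤ northSteps M.U p := mU hup
  -- The last two conditions make the removal of `x` use up any slack that `M₁` has over `M` at `w`
  -- and preserve the bound at `v`. They never compete: `l ≤ w < e ≤ v < u` together with the east
  -- step `e` of `B` contradicts `u - l ≤ U(u) - L(l)`. The condition `L(l) ≤ U(u)` makes `B`
  -- strictly higher at `p` than at `q`.
  have hx : ∃ x ∈ B, q < x ∧ x ≤ p ∧ (v < u → v < x) ∧ (l ≤ w → x ≤ w) := by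
    by_cases h1 : v < u
    · have hvU : northSteps M.U v ≤ northSteps M.U (u - 1) := mU (by omega)
      by_cases h2 : l ≤ w
      · exfalso
        have k1 := northSteps_le_add M.U h1.le
        have k2 := northSteps_le_add M.L h2
        obtain ⟨e', rfl⟩ : ∃ e', e = e' + 1 := ⟨e - 1, by omega⟩
        have k3 := northSteps_succ B e'
        rw [if_neg heB] at k3
        have k4 := northSteps_le_add B hev
        have k5 := northSteps_le_add B (show w ≤ e' by omega)
        omega
      · obtain ⟨x, hxB, hx1, hx2⟩ := exists_mem_of_northSteps_lt (A := B) (a := max v q) (b := p)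
          (by rcases max_choice v q with h | h <;> rw [h] <;> omega)
        exact ⟨x, hxB, by omega, hx2, by omega, by omega⟩
    · by_cases h2 : l ≤ w
      · have hwL : northSteps M.L l ≤ northSteps M.L w := mL h2
        obtain ⟨x, hxB, hx1, hx2⟩ := exists_mem_of_northSteps_lt (A := B) (a := q) (b := min w p)
          (by rcases min_choice w p with h | h <;> rw [h] <;> omega)
        exact ⟨x, hxB, hx1, by omega, by omega, by omega⟩
      · obtain ⟨x, hxB, hx1, hx2⟩ := exists_mem_of_northSteps_lt (A := B) (a := q) (b := p)
          (by omega)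
        exact ⟨x, hxB, hx1, hx2, by omega, by omega⟩
  obtain ⟨x, hxB, hqx, hxp, hvx, hxw⟩ := hx
  refine ⟨x, hxB, ?_, fun f hf hfx hD => ?_⟩
  · rw [isPathBetween_iff]
    refine ⟨(Finset.erase_subset _ _).trans hBn, fun i _ => ?_⟩
    have a1 := northSteps_erase hxB i
    have a2 := northSteps_erase hu i
    have a3 := northSteps_erase hl i
    have a4 := hBb i
    have a5 := hq' i
    have a6 := hp' i
    rw [hU, hL]
    split_ifs at a1 a2 a3 <;> omega
  · have b0 := northSteps_exchange (A := B.erase x) (x := f) (y := e) (by simp [hf, hfx])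
      (by simp [heB])
    -- Compare with the lower bound of `M₁` at the contact `w`: if `l ≤ w`, the one unit of slack is
    -- already spent on `x`.
    have hfw : w < f := by
      have c1 := (hD.2.2 w).1
      rw [hL] at c1
      have c2 := b0 w
      have c3 := northSteps_erase hxB w
      have c4 := northSteps_erase hl w
      rw [if_neg (show ¬e ≤ w by omega)] at c2
      split_ifs at c2 c3 c4 <;> omega
    have hfv : f ≤ v := by
      have c1 := (hD.2.2 v).2
      rw [hU] at c1
      have c2 := b0 v
      have c3 := northSteps_erase hxB v
      have c4 := northSteps_erase hu v
      rw [if_pos hev] at c2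
      split_ifs at c2 c3 c4 <;> omega
    rw [isPathBetween_iff]
    refine ⟨Finset.insert_subset he ((Finset.erase_subset _ _).trans hBn), fun i _ => ?_⟩
    have a1 := northSteps_exchange hf heB i
    have a2 := hBb i
    have a3 := hw' i
    have a4 := hv' i
    split_ifs at a1 <;> omega

end LPM

namespace LPM

variable {n : ℕ}

theorem le_iff_closure_subset {M' M : LPM n} :
    M' ≤ M ↔ ∀ X, M.toMatroid.closure X ⊆ M'.toMatroid.closure X :=
  ⟨fun h X => IsMatroidQuotient.closure_subset h X,
    fun h => isMatroidQuotient_of_closure_subset (Set.finite_Icc 1 n) rfl h⟩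

/-- Suppose `e` lies in the closure of `X` in `M` but not in `M₁`. Extend a basis `I` of `X` in `M`
to a base `B`. In the base `D` of `M₁` supplied by the exchange lemma, `e` can replace some `f`
outside `I`; the same exchange in `B` is then legal in `M` and makes `I ∪ {e}` independent, a
contradiction. -/
theorem IsGoodPair.erase_le {M M₁ : LPM n} {l u : ℕ} (hg : M.IsGoodPair l u)
    (hU : M₁.U = M.U.erase u) (hL : M₁.L = M.L.erase l) : M₁ ≤ M := by
  rw [le_iff_closure_subset]
  intro X e he
  have heE : e ∈ Set.Icc 1 n := M.toMatroid.closure_subset_ground X he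
  obtain ⟨I, hI⟩ := M.toMatroid.exists_isBasis' X
  rw [← hI.closure_eq_closure] at he
  by_cases heX : e ∈ X
  · exact M₁.toMatroid.mem_closure_of_mem' heX heE
  have heI : e ∉ I := fun h => heX (hI.subset h)
  have hdep : ¬ M.toMatroid.Indep (insert e I) := fun h =>
    (hI.indep.notMem_closure_iff heE).2 ⟨h, heI⟩ he
  obtain ⟨B, hIB, hB⟩ := M.exists_isPathBetween_of_indep hI.indep
  have heB : e ∉ B := fun h => hdep (hB.indep (Set.insert_subset h hIB))
  obtain ⟨x, hxB, hD, hx⟩ := hg.exists_exchange hU hL hB heB (Finset.mem_Icc.2 heE)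
  refine M₁.toMatroid.closure_subset_closure hI.subset ?_
  by_contra hcl
  set D := B.erase x
  have hDI : M₁.toMatroid.Indep (D ∩ I) := hD.indep Set.inter_subset_left
  have h1 : e ∉ M₁.toMatroid.closure (D ∩ I) := fun h =>
    hcl (M₁.toMatroid.closure_subset_closure Set.inter_subset_right h)
  rw [hDI.notMem_closure_iff heE] at h1
  -- Completing `(D ∩ I) ∪ {e}` inside `D` forces `C` to be `D` with one element outside `I` traded
  -- for `e`.
  obtain ⟨C, hC, hC1, hC2⟩ := h1.1.exists_isBase_subset_union_isBase
    ((M₁.toMatroid_isBase_iff D).2 hD)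
  obtain ⟨C, rfl, hCp⟩ := M₁.exists_isPathBetween_of_isBase hC
  have heC : e ∈ C := hC1 (Set.mem_insert _ _)
  have heD : e ∉ D := fun h => heB (Finset.mem_of_mem_erase h)
  have hCD : C.erase e ⊆ D := by
    intro y hy
    rw [Finset.mem_erase] at hy
    rcases hC2 hy.2 with (h | h) | h
    · exact absurd h hy.1
    · exact h.1
    · exact h
  have hcard : (D \ C.erase e).card = 1 := by
    have k1 := Finset.card_sdiff_add_card_eq_card hCD
    have k2 := Finset.card_erase_add_one heC
    have k3 := hCp.2.1
    have k4 := hD.2.1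
    omega
  obtain ⟨f, hf⟩ := Finset.card_eq_one.1 hcard
  have hfD : f ∈ D \ C.erase e := by rw [hf]; exact Finset.mem_singleton_self f
  rw [Finset.mem_sdiff] at hfD
  have hfB := Finset.mem_of_mem_erase hfD.1
  have hfe : f ≠ e := fun h => heD (h ▸ hfD.1)
  have hfI : f ∉ I := fun h =>
    hfD.2 (Finset.mem_erase.2 ⟨hfe, hC1 (Set.mem_insert_of_mem _ ⟨hfD.1, h⟩)⟩)
  have hCeq : C = insert e (D.erase f) := by
    rw [← Finset.insert_erase heC]
    congr 1
    rw [Finset.erase_eq D, ← hf, Finset.sdiff_sdiff_eq_self hCD]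
  rw [hCeq] at hCp
  have := hx f hfB (Finset.ne_of_mem_erase hfD.1) hCp
  refine hdep (this.indep ?_)
  rw [Finset.coe_insert, Finset.coe_erase]
  exact Set.insert_subset_insert fun y hy => ⟨hIB hy, fun h => hfI (h ▸ hy)⟩

/-! ## Consequences of being a quotient -/

/-- The hypothesis lets a base of `M` avoid `(a, b]`, so the complement of this interval spans `M`.
It then spans the quotient `M'`, which therefore has a path that is flat on `(a, b]`. -/
theorem northSteps_L_le_of_le {M' M : LPM n} (h : M' ≤ M) {a b : ℕ} (hab : a ≤ b) (hb : b ≤ n)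
    (hM : northSteps M.L b ≤ northSteps M.U a) : northSteps M'.L b ≤ northSteps M'.U a := by
  have hcl := le_iff_closure_subset.1 h
  have hmono := northSteps_mono
  -- `A` follows `U` for `a` steps, then runs east until `L` pushes it up.
  obtain ⟨A, hAn, hA⟩ := exists_path_of_heights n
    (fun i => if i ≤ a then northSteps M.U i else max (northSteps M.U a) (northSteps M.L i))
    (by simp [northSteps_zero M.U_subset])
    (fun i _ => by
      have k1 := northSteps_le_succ M.U i
      have k2 := northSteps_le_succ M.L i
      have k3 := M.noncrossing i
      split_ifs with c1 c2
      · exact k1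
      · obtain rfl : i = a := by omega
        omega
      · omega
      · omega)
  have hAp : M.IsPathBetween A := by
    rw [isPathBetween_iff]
    refine ⟨hAn, fun i hi => ?_⟩
    rw [hA i hi]
    have k3 := M.noncrossing i
    split_ifs with c1
    · exact ⟨k3, le_rfl⟩
    · have := hmono M.U (show a ≤ i by omega)
      omega
  have hAX : (A : Set ℕ) ⊆ {x | x ∈ Set.Icc 1 n ∧ ¬ (a < x ∧ x ≤ b)} := by
    intro x hx
    have hxn := Finset.mem_Icc.1 (hAn hx)
    refine ⟨hxn, fun ⟨h1, h2⟩ => ?_⟩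
    have k1 := northSteps_pred_of_mem hx hxn.1
    have k2 := hA x hxn.2
    have k3 := hA a (by omega)
    have k4 := hmono A (show a ≤ x - 1 by omega)
    have k5 := hmono M.L h2
    rw [if_neg (by omega)] at k2
    rw [if_pos le_rfl] at k3
    omega
  set X : Set ℕ := {x | x ∈ Set.Icc 1 n ∧ ¬ (a < x ∧ x ≤ b)} with hX
  have hsp : M'.toMatroid.Spanning X := by
    rw [Matroid.spanning_iff_ground_subset_closure (fun x hx => hx.1)]
    refine Set.Subset.trans ?_ (hcl X)
    refine Set.Subset.trans ?_ (M.toMatroid.closure_subset_closure hAX)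
    rw [((M.toMatroid_isBase_iff A).2 hAp).closure_eq]
    exact Set.Subset.rfl
  obtain ⟨B, hB, hBX⟩ := hsp.exists_isBase_subset
  obtain ⟨B, rfl, hBp⟩ := M'.exists_isPathBetween_of_isBase hB
  have k1 : northSteps B b ≤ northSteps B a := by
    by_contra! hlt
    obtain ⟨x, hx, h1, h2⟩ := exists_mem_of_northSteps_lt hlt
    exact (hBX hx).2 ⟨h1, h2⟩
  exact ((hBp.2.2 b).1.trans k1).trans (hBp.2.2 a).2

/-- Independent sets of `M'` are independent in `M`, and no path of `M` has more than `U(b) - L(a)`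
north steps in `(a, b]`. The hypothesis says that this number is less than `b - a`, so it is the
bound `U'`, not the length of the interval, that limits the steepest path of `M'` there. -/
theorem northSteps_sub_le_of_le {M' M : LPM n} (h : M' ≤ M) {a b : ℕ} (hab : a ≤ b) (hb : b ≤ n)
    (hM : northSteps M.U b < northSteps M.L a + (b - a)) :
    northSteps M'.U b + northSteps M.L a ≤ northSteps M.U b + northSteps M'.L a := by
  have hcl := le_iff_closure_subset.1 h
  have hmono := northSteps_mono
  -- `A` follows `M'.L` for `a` steps, then climbs as fast as `M'.U` permits.
  obtain ⟨A, hAn, hA⟩ := exists_path_of_heights n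
    (fun i => if i ≤ a then northSteps M'.L i else
      min (northSteps M'.L a + (i - a)) (northSteps M'.U i))
    (by simp [northSteps_zero M'.L_subset])
    (fun i _ => by
      have k1 := northSteps_le_succ M'.U i
      have k2 := northSteps_le_succ M'.L i
      have k3 := M'.noncrossing i
      split_ifs with c1 c2
      · exact k2
      · obtain rfl : i = a := by omega
        omega
      · omega
      · omega)
  have hAp : M'.IsPathBetween A := by
    rw [isPathBetween_iff]
    refine ⟨hAn, fun i hi => ?_⟩
    rw [hA i hi]
    have k3 := M'.noncrossing i
    split_ifs with c1
    · exact ⟨le_rfl, k3⟩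
    · have := northSteps_le_add M'.L (show a ≤ i by omega)
      omega
  have hI : M.toMatroid.Indep ((A ∩ Finset.Ioc a b : Finset ℕ) : Set ℕ) := by
    refine indep_of_closure_subset (M' := M'.toMatroid) (M := M.toMatroid) rfl hcl (hAp.indep ?_)
    exact_mod_cast Finset.inter_subset_left
  obtain ⟨B, hIB, hBp⟩ := M.exists_isPathBetween_of_indep hI
  have k1 := card_inter_Ioc A hab
  have k2 := card_inter_Ioc B hab
  have k3 : (A ∩ Finset.Ioc a b).card ≤ (B ∩ Finset.Ioc a b).card :=
    Finset.card_le_card fun x hx =>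
      Finset.mem_inter.2 ⟨hIB hx, (Finset.mem_inter.1 hx).2⟩
  have k4 := hBp.2.2 a
  have k5 := hBp.2.2 b
  have k6 := hA a (by omega)
  have k7 := hA b hb
  have k8 := M'.noncrossing b
  have k9 := northSteps_le_add M'.L hab
  rw [if_pos le_rfl] at k6
  split_ifs at k7 with c1
  · obtain rfl : a = b := by omega
    omega
  · omega

/-- If the path `A` has as many north steps as possible both in `S` and in `S ∪ {e}`, then `e` is
in the closure of `S` iff it is not a north step of `A`. -/
theorem IsPathBetween.mem_closure_iff {M : LPM n} {A : Finset ℕ} (hA : M.IsPathBetween A)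
    {S : Finset ℕ} {e : ℕ} (he : e ∈ Set.Icc 1 n) (heS : e ∉ S) (hSn : S ⊆ Finset.Icc 1 n)
    (h1 : ∀ B : Finset ℕ, M.IsPathBetween B → (B ∩ S).card ≤ (A ∩ S).card)
    (h2 : ∀ B : Finset ℕ, M.IsPathBetween B → (B ∩ insert e S).card ≤ (A ∩ insert e S).card) :
    e ∈ M.toMatroid.closure S ↔ e ∉ A := by
  have hJ : M.toMatroid.Indep ((A ∩ S : Finset ℕ) : Set ℕ) :=
    hA.indep (by exact_mod_cast Finset.inter_subset_left)
  have hJS : ((A ∩ S : Finset ℕ) : Set ℕ) ⊆ S := by exact_mod_cast Finset.inter_subset_right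
  have heJ : e ∉ ((A ∩ S : Finset ℕ) : Set ℕ) := fun h => heS (hJS h)
  constructor
  · intro hcl heA
    obtain ⟨I, hI, hJI⟩ := hJ.subset_isBasis_of_subset hJS
      (fun x hx => Finset.mem_Icc.1 (hSn hx))
    obtain ⟨B, hIB, hB⟩ := M.exists_isPathBetween_of_indep hI.indep
    have hIBS : I ⊆ ((B ∩ S : Finset ℕ) : Set ℕ) := fun x hx => by
      simpa using ⟨hIB hx, hI.subset hx⟩
    have hBS : A ∩ S = B ∩ S := Finset.eq_of_subset_of_card_le
      (by exact_mod_cast hJI.trans hIBS) (h1 B hB)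
    have hIJ : I = ((A ∩ S : Finset ℕ) : Set ℕ) := (hBS ▸ hIBS).antisymm hJI
    rw [← hI.closure_eq_closure, hIJ] at hcl
    refine (hJ.notMem_closure_iff he).2 ⟨hA.indep (Set.insert_subset heA ?_), heJ⟩ hcl
    exact_mod_cast Finset.inter_subset_left
  · intro heA
    by_contra hcl
    have hcl' : e ∉ M.toMatroid.closure ((A ∩ S : Finset ℕ) : Set ℕ) := fun h =>
      hcl (M.toMatroid.closure_subset_closure hJS h)
    rw [hJ.notMem_closure_iff he] at hcl'
    obtain ⟨B, hIB, hB⟩ := M.exists_isPathBetween_of_indep hcl'.1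
    have k1 := h2 B hB
    rw [Finset.inter_insert_of_notMem heA] at k1
    have k2 : insert e (A ∩ S) ⊆ B ∩ insert e S := by
      intro x hx
      refine Finset.mem_inter.2 ⟨hIB (by exact_mod_cast hx), ?_⟩
      exact Finset.insert_subset_insert _ Finset.inter_subset_right hx
    have k3 := Finset.card_le_card k2
    rw [Finset.card_insert_of_notMem (by exact_mod_cast heJ)] at k3
    omega

/-- The upper path has the most north steps of all bases in every initial segment; dually, the lower
path has the most in every final segment. -/
theorem mem_closure_Ioc_zero_iff (M : LPM n) {e : ℕ} (he : e ∈ Set.Icc 1 n) :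
    e ∈ M.toMatroid.closure (Finset.Ioc 0 (e - 1) : Finset ℕ) ↔ e ∉ M.U := by
  obtain ⟨he1, hen⟩ := id he
  have key : ∀ b (B : Finset ℕ), M.IsPathBetween B →
      (B ∩ Finset.Ioc 0 b).card ≤ (M.U ∩ Finset.Ioc 0 b).card := fun b B hB => by
    have k1 := card_inter_Ioc B (Nat.zero_le b)
    have k2 := card_inter_Ioc M.U (Nat.zero_le b)
    have k3 := northSteps_zero hB.1
    have k4 := northSteps_zero M.U_subset
    have k5 := (hB.2.2 b).2
    omega
  have hins : insert e (Finset.Ioc 0 (e - 1)) = Finset.Ioc 0 e := by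
    ext x; simp only [Finset.mem_insert, Finset.mem_Ioc]; omega
  refine M.isPathBetween_U.mem_closure_iff he (by rw [Finset.mem_Ioc]; omega) ?_ (key _) (hins ▸ key e)
  intro x; simp only [Finset.mem_Ioc, Finset.mem_Icc]; omega

theorem mem_closure_Ioc_iff (M : LPM n) {e : ℕ} (he : e ∈ Set.Icc 1 n) :
    e ∈ M.toMatroid.closure (Finset.Ioc e n : Finset ℕ) ↔ e ∉ M.L := by
  obtain ⟨he1, hen⟩ := id he
  have key : ∀ a ≤ n, ∀ (B : Finset ℕ), M.IsPathBetween B →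
      (B ∩ Finset.Ioc a n).card ≤ (M.L ∩ Finset.Ioc a n).card := fun a ha B hB => by
    have k1 := card_inter_Ioc B ha
    have k2 := card_inter_Ioc M.L ha
    have k3 := hB.northSteps_n
    have k4 := M.isPathBetween_L.northSteps_n
    have k5 := (hB.2.2 a).1
    omega
  have hins : insert e (Finset.Ioc e n) = Finset.Ioc (e - 1) n := by
    ext x; simp only [Finset.mem_insert, Finset.mem_Ioc]; omega
  refine M.isPathBetween_L.mem_closure_iff he (by simp) ?_ (key _ hen)
    (hins ▸ key (e - 1) (by omega))
  intro x; simp only [Finset.mem_Ioc, Finset.mem_Icc]; omega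

theorem U_subset_of_le {M' M : LPM n} (h : M' ≤ M) : M'.U ⊆ M.U := fun e he => by
  have heE : e ∈ Set.Icc 1 n := Finset.mem_Icc.1 (M'.U_subset he)
  by_contra heM
  exact (M'.mem_closure_Ioc_zero_iff heE).1
    (le_iff_closure_subset.1 h _ ((M.mem_closure_Ioc_zero_iff heE).2 heM)) he

theorem L_subset_of_le {M' M : LPM n} (h : M' ≤ M) : M'.L ⊆ M.L := fun e he => by
  have heE : e ∈ Set.Icc 1 n := Finset.mem_Icc.1 (M'.L_subset he)
  by_contra heM
  exact (M'.mem_closure_Ioc_iff heE).1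
    (le_iff_closure_subset.1 h _ ((M.mem_closure_Ioc_iff heE).2 heM)) he

/-- The combinatorial description of the order: `M'` arises from `M` by removing elements of `L` and
of `U` which are good pairs when they are matched in increasing order. -/
structure GoodPairsLE (M' M : LPM n) : Prop where
  U_subset : M'.U ⊆ M.U
  L_subset : M'.L ⊆ M.L
  isGoodPair : ∀ l ∈ M.L \ M'.L, ∀ u ∈ M.U \ M'.U,
    northSteps (M.L \ M'.L) l = northSteps (M.U \ M'.U) u → M.IsGoodPair l u

/-- If `l` and `u` are both the `i`-th removed elements, exactly `i - 1` elements are removed from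
`L` before `l` and from `U` before `u`. A failure of either good pair condition then violates one of
the two height inequalities by one. -/
theorem GoodPairsLE.of_le {M' M : LPM n} (h : M' ≤ M) : GoodPairsLE M' M := by
  have hU := U_subset_of_le h
  have hL := L_subset_of_le h
  refine ⟨hU, hL, fun l hl u hu heq => ?_⟩
  have dU := northSteps_sdiff hU
  have dL := northSteps_sdiff hL
  have hlM := (Finset.mem_sdiff.1 hl).1
  have huM := (Finset.mem_sdiff.1 hu).1
  have hun := Finset.mem_Icc.1 (M.U_subset huM)
  have hln := Finset.mem_Icc.1 (M.L_subset hlM)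
  have lpred := northSteps_pred_of_mem hl hln.1
  have upred := northSteps_pred_of_mem hu hun.1
  have lMpred := northSteps_pred_of_mem hlM hln.1
  have uMpred := northSteps_pred_of_mem huM hun.1
  have hle : northSteps M.L l ≤ northSteps M.U u := by
    by_contra! hlt
    have hul : u < l := by
      by_contra! hlu
      have k1 := northSteps_mono M.L hlu
      have k2 := M.noncrossing u
      omega
    -- the last step where `M.L` has height at most that of `M.U` at `u`
    obtain ⟨b, hb1, hb2, hb3⟩ : ∃ b, u ≤ b ∧ b < l ∧ northSteps M.L b = northSteps M.U u := by
      have hex : ∃ i, northSteps M.U u < northSteps M.L i := ⟨l, hlt⟩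
      classical
      have k1 := Nat.find_spec hex
      have k2 := Nat.find_min' hex hlt
      have k3 : u < Nat.find hex := by
        by_contra! hc
        have k4 := northSteps_mono M.L hc
        have k5 := M.noncrossing u
        omega
      obtain ⟨b, hb⟩ : ∃ b, Nat.find hex = b + 1 := ⟨Nat.find hex - 1, by omega⟩
      have k6 := Nat.find_min hex (m := b) (by omega)
      have k7 := northSteps_le_succ M.L b
      rw [hb] at k1
      exact ⟨b, by omega, by omega, by omega⟩
    have k1 := northSteps_L_le_of_le h hb1 (by omega) hb3.le
    have k2 := dL b
    have k3 := dU u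
    have k4 := northSteps_mono (M.L \ M'.L) (show b ≤ l - 1 by omega)
    omega
  refine ⟨hlM, huM, hle, ?_⟩
  by_contra! hlt
  -- Stopping at `u - 1` counts `l` among the removed elements of `L` but not `u` among those of
  -- `U`.
  have k1 := northSteps_sub_le_of_le h (a := l) (b := u - 1) (by omega) (by omega) (by omega)
  have k2 := dL l
  have k3 := dU (u - 1)
  omega

end LPM

/-! ### Adding the largest missing pair, and the covers of `𝓟ₙ` -/

theorem northSteps_of_forall_le {A : Finset ℕ} {m : ℕ} (h : ∀ x ∈ A, x ≤ m) :
    northSteps A m = A.card := by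
  rw [northSteps, Finset.filter_true_of_mem h]

namespace LPM

variable {n : ℕ}

theorem card_sdiff_eq {M' M : LPM n} (hU : M'.U ⊆ M.U) (hL : M'.L ⊆ M.L) :
    (M.L \ M'.L).card = (M.U \ M'.U).card := by
  rw [Finset.card_sdiff_of_subset hU, Finset.card_sdiff_of_subset hL, M.card_eq, M'.card_eq]

theorem eq_of_card_U_le {M' M : LPM n} (hU : M'.U ⊆ M.U) (hL : M'.L ⊆ M.L)
    (h : M.U.card ≤ M'.U.card) : M' = M :=
  LPM.ext (Finset.eq_of_subset_of_card_le hU h)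
    (Finset.eq_of_subset_of_card_le hL (by rw [← M.card_eq, ← M'.card_eq]; exact h))

/-- `M₁` arises from `M'` by adding `l` to the lower and `u` to the upper path, where `(l, u)` is a
good pair of `M₁`. -/
structure AddsGoodPair (M' M₁ : LPM n) (l u : ℕ) : Prop where
  notMem_L : l ∉ M'.L
  notMem_U : u ∉ M'.U
  L_eq : M₁.L = insert l M'.L
  U_eq : M₁.U = insert u M'.U
  isGoodPair : M₁.IsGoodPair l u

namespace AddsGoodPair

variable {M' M₁ : LPM n} {l u : ℕ}

theorem le (h : AddsGoodPair M' M₁ l u) : M' ≤ M₁ :=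
  h.isGoodPair.erase_le (by rw [h.U_eq, Finset.erase_insert h.notMem_U])
    (by rw [h.L_eq, Finset.erase_insert h.notMem_L])

theorem card_eq (h : AddsGoodPair M' M₁ l u) : M₁.U.card = M'.U.card + 1 := by
  rw [h.U_eq, Finset.card_insert_of_notMem h.notMem_U]

theorem L_sdiff (h : AddsGoodPair M' M₁ l u) : M₁.L \ M'.L = {l} := by
  rw [h.L_eq, Finset.insert_sdiff_of_notMem _ h.notMem_L, Finset.sdiff_self]
  rfl

theorem U_sdiff (h : AddsGoodPair M' M₁ l u) : M₁.U \ M'.U = {u} := by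
  rw [h.U_eq, Finset.insert_sdiff_of_notMem _ h.notMem_U, Finset.sdiff_self]
  rfl

theorem mem_L_sdiff (h : AddsGoodPair M' M₁ l u) {M : LPM n} (hM : M₁ ≤ M) : l ∈ M.L \ M'.L :=
  Finset.mem_sdiff.2 ⟨L_subset_of_le hM (h.L_eq ▸ Finset.mem_insert_self _ _), h.notMem_L⟩

theorem mem_U_sdiff (h : AddsGoodPair M' M₁ l u) {M : LPM n} (hM : M₁ ≤ M) : u ∈ M.U \ M'.U :=
  Finset.mem_sdiff.2 ⟨U_subset_of_le hM (h.U_eq ▸ Finset.mem_insert_self _ _), h.notMem_U⟩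

theorem unique (h : AddsGoodPair M' M₁ l u) {M₂ : LPM n} (h₂ : AddsGoodPair M' M₂ l u) :
    M₁ = M₂ :=
  LPM.ext (h.U_eq.trans h₂.U_eq.symm) (h.L_eq.trans h₂.L_eq.symm)

theorem labels_unique (h : AddsGoodPair M' M₁ l u) {l₂ u₂ : ℕ} (h₂ : AddsGoodPair M' M₁ l₂ u₂) :
    l = l₂ ∧ u = u₂ :=
  ⟨Finset.singleton_injective (h.L_sdiff.symm.trans h₂.L_sdiff),
    Finset.singleton_injective (h.U_sdiff.symm.trans h₂.U_sdiff)⟩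

end AddsGoodPair

theorem card_lt_card_of_lt {M' M : LPM n} (h : M' < M) : M'.U.card < M.U.card := by
  by_contra! hc
  exact h.ne (eq_of_card_U_le (U_subset_of_le h.le) (L_subset_of_le h.le) hc)

theorem AddsGoodPair.covBy {M' M₁ : LPM n} {l u : ℕ} (h : AddsGoodPair M' M₁ l u) : M' ⋖ M₁ := by
  have hc := h.card_eq
  refine ⟨lt_of_le_of_ne h.le fun he => ?_, fun M₂ h1 h2 => ?_⟩
  · rw [he] at hc; omega
  · have := card_lt_card_of_lt h1
    have := card_lt_card_of_lt h2
    omega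

/-- Put back the maxima `l` and `u` of the two differences. Relative to `M` their indices drop by
the same amount, so the pair is good in `M₁`; the other removed elements are smaller and keep their
matching. -/
theorem GoodPairsLE.exists_add {M' M : LPM n} (h : GoodPairsLE M' M) (hne : M' ≠ M) :
    ∃ (M₁ : LPM n) (l u : ℕ), AddsGoodPair M' M₁ l u ∧ GoodPairsLE M₁ M ∧
      (∀ x ∈ M.L \ M'.L, x ≤ l) ∧ (∀ x ∈ M.U \ M'.U, x ≤ u) := by
  obtain ⟨hU, hL, hg⟩ := h
  have hc := card_sdiff_eq hU hL
  have hUne : (M.U \ M'.U).Nonempty := by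
    rw [Finset.nonempty_iff_ne_empty, Ne, Finset.sdiff_eq_empty_iff_subset]
    exact fun hs => hne (eq_of_card_U_le hU hL (Finset.card_le_card hs))
  have hLne : (M.L \ M'.L).Nonempty := by
    rw [← Finset.card_pos, hc, Finset.card_pos]; exact hUne
  obtain ⟨l, hl, hlmax⟩ := Finset.exists_max_image _ id hLne
  obtain ⟨u, hu, humax⟩ := Finset.exists_max_image _ id hUne
  simp only [id] at hlmax humax
  obtain ⟨hlM, hlM'⟩ := Finset.mem_sdiff.1 hl
  obtain ⟨huM, huM'⟩ := Finset.mem_sdiff.1 hu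
  have dU := northSteps_sdiff hU
  have dL := northSteps_sdiff hL
  have cl := northSteps_of_forall_le hlmax
  have cu := northSteps_of_forall_le humax
  obtain ⟨-, -, hle, hsub⟩ := hg l hl u hu (by rw [cl, cu, hc])
  have iL := northSteps_insert hlM'
  have iU := northSteps_insert huM'
  have hun := Finset.mem_Icc.1 (M.U_subset huM)
  have hln := Finset.mem_Icc.1 (M.L_subset hlM)
  have hLn : insert l M'.L ⊆ M.L := Finset.insert_subset hlM hL
  have hUn : insert u M'.U ⊆ M.U := Finset.insert_subset huM hU
  have sL : M.L \ insert l M'.L = (M.L \ M'.L).erase l := Finset.sdiff_insert _ _ _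
  have sU : M.U \ insert u M'.U = (M.U \ M'.U).erase u := Finset.sdiff_insert _ _ _
  let M₁ : LPM n :=
    { U := insert u M'.U
      L := insert l M'.L
      U_subset := hUn.trans M.U_subset
      L_subset := hLn.trans M.L_subset
      card_eq := by
        rw [Finset.card_insert_of_notMem huM', Finset.card_insert_of_notMem hlM', M'.card_eq]
      noncrossing := fun i => by
        have a1 := iL i
        have a2 := iU i
        have a3 := M'.noncrossing i
        by_cases h1 : u ≤ i
        · rw [if_pos h1] at a2
          split_ifs at a1 <;> omega
        · rw [if_neg h1] at a2
          -- The paths could cross only for `l ≤ i < u`. There all of `M.L \ M'.L` has been passed,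
          -- but not `u`, so noncrossing in `M` leaves a gap of at least one in `M'`.
          by_cases h2 : l ≤ i
          · have a4 := dL i
            have a5 := dU i
            have a6 := M.noncrossing i
            have a7 := northSteps_mono (M.L \ M'.L) h2
            have a8 := northSteps_mono (M.U \ M'.U) (show i ≤ u - 1 by omega)
            have a9 := northSteps_pred_of_mem hu hun.1
            rw [if_pos h2] at a1
            omega
          · rw [if_neg h2] at a1
            omega }
  refine ⟨M₁, l, u, ⟨hlM', huM', rfl, rfl, ?_⟩, ⟨hUn, hLn, fun x hx y hy hxy => ?_⟩, hlmax, humax⟩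
  · refine ⟨Finset.mem_insert_self _ _, Finset.mem_insert_self _ _, ?_, ?_⟩
    all_goals
      have a1 := iL l
      have a2 := iU u
      have a3 := dL l
      have a4 := dU u
      rw [if_pos le_rfl] at a1 a2
      simp only [M₁]
      omega
  · change x ∈ M.L \ insert l M'.L at hx
    change y ∈ M.U \ insert u M'.U at hy
    change northSteps (M.L \ insert l M'.L) x = northSteps (M.U \ insert u M'.U) y at hxy
    rw [sL] at hx hxy
    rw [sU] at hy hxy
    have hxl := hlmax x (Finset.mem_of_mem_erase hx)
    have hyu := humax y (Finset.mem_of_mem_erase hy)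
    have hxl' := Finset.ne_of_mem_erase hx
    have hyu' := Finset.ne_of_mem_erase hy
    have a1 := northSteps_erase hl x
    have a2 := northSteps_erase hu y
    rw [if_neg (by omega)] at a1 a2
    exact hg x (Finset.mem_of_mem_erase hx) y (Finset.mem_of_mem_erase hy) (by omega)

theorem le_of_goodPairsLE {M' M : LPM n} (h : GoodPairsLE M' M) : M' ≤ M := by
  by_cases hne : M' = M
  · exact hne.le
  · obtain ⟨M₁, l, u, h1, h2, -, -⟩ := h.exists_add hne
    have := h1.card_eq
    have := Finset.card_le_card h2.U_subset
    exact h1.le.trans (le_of_goodPairsLE h2)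
termination_by M.U.card - M'.U.card
decreasing_by omega

/-- `M₁` is the element that the increasing maximal chain of `[M', M]` visits after `M'`. -/
def IsMaxAdd (M' M₁ M : LPM n) (l u : ℕ) : Prop :=
  AddsGoodPair M' M₁ l u ∧ M₁ ≤ M ∧ (∀ x ∈ M.L \ M'.L, x ≤ l) ∧ (∀ x ∈ M.U \ M'.U, x ≤ u)

theorem exists_isMaxAdd {M' M : LPM n} (h : M' < M) : ∃ M₁ l u, IsMaxAdd M' M₁ M l u := by
  obtain ⟨M₁, l, u, h1, h2, h3, h4⟩ := (GoodPairsLE.of_le h.le).exists_add h.ne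
  exact ⟨M₁, l, u, h1, le_of_goodPairsLE h2, h3, h4⟩

/-- The greedy step from `M'` towards `M` stays in `[M', M]`, so for a cover it ends at `M`. -/
theorem exists_addsGoodPair {M' M : LPM n} (h : M' ⋖ M) : ∃ l u, AddsGoodPair M' M l u := by
  obtain ⟨M₁, l, u, h1, h2, -, -⟩ := exists_isMaxAdd h.lt
  obtain rfl : M₁ = M := by
    by_contra hne
    exact h.2 h1.covBy.lt (lt_of_le_of_ne h2 hne)
  exact ⟨l, u, h1⟩

end LPM

/-! ## The good pair labeling -/

namespace LPM

variable {n : ℕ}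

theorem exists_isGoodPairLabeling (n : ℕ) :
    ∃ lam : EdgeLabeling (LPM n) (LabelPoset n), ∀ ⦃M' M : LPM n⦄ (h : M' ⋖ M),
      AddsGoodPair M' M (OrderDual.ofDual (lam h)).1 (OrderDual.ofDual (lam h)).2 := by
  have key : ∀ M' M : LPM n, ∀ h : M' ⋖ M, ∃ p : LabelPoset n,
      AddsGoodPair M' M (OrderDual.ofDual p).1 (OrderDual.ofDual p).2 := by
    intro M' M h
    obtain ⟨l, u, hlu⟩ := exists_addsGoodPair h
    exact ⟨OrderDual.toDual (⟨l, Finset.mem_Icc.1 (M.L_subset hlu.isGoodPair.1)⟩,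
      ⟨u, Finset.mem_Icc.1 (M.U_subset hlu.isGoodPair.2.1)⟩), hlu⟩
  choose lam hlam using key
  exact ⟨fun M' M h => lam M' M h, fun M' M h => hlam M' M h⟩

theorem isGoodPairLabeling_of_addsGoodPair {lam : EdgeLabeling (LPM n) (LabelPoset n)}
    (hlam : ∀ ⦃M' M : LPM n⦄ (h : M' ⋖ M),
      AddsGoodPair M' M (OrderDual.ofDual (lam h)).1 (OrderDual.ofDual (lam h)).2) :
    IsGoodPairLabeling lam := fun M' M h =>
  have hM := hlam h
  ⟨by rw [hM.L_eq]; exact Finset.subset_insert _ _, by rw [hM.U_eq]; exact Finset.subset_insert _ _,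
    hM.L_sdiff, hM.U_sdiff, hM.isGoodPair⟩

end LPM

theorem SaturatedChain.le {P : Type*} [PartialOrder P] {x y : P} (C : SaturatedChain x y) :
    x ≤ y := by
  induction C with
  | nil => exact le_rfl
  | cons h _ ih => exact h.le.trans ih

/-! ### The EL-property -/

namespace LPM

variable {n : ℕ} {lam : EdgeLabeling (LPM n) (LabelPoset n)}

theorem mem_sdiff_of_mem_labels
    (hlam : ∀ ⦃M' M : LPM n⦄ (h : M' ⋖ M),
      AddsGoodPair M' M (OrderDual.ofDual (lam h)).1 (OrderDual.ofDual (lam h)).2)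
    {x y : LPM n} (C : SaturatedChain x y) : ∀ p ∈ C.labels lam,
      ((OrderDual.ofDual p).1 : ℕ) ∈ y.L \ x.L ∧ ((OrderDual.ofDual p).2 : ℕ) ∈ y.U \ x.U := by
  induction C with
  | nil => intro p hp; simp [SaturatedChain.labels] at hp
  | cons h C ih =>
    intro p hp
    rw [SaturatedChain.labels, List.mem_cons] at hp
    rcases hp with rfl | hp
    · exact ⟨(hlam h).mem_L_sdiff C.le, (hlam h).mem_U_sdiff C.le⟩
    · exact ⟨Finset.sdiff_subset_sdiff subset_rfl (L_subset_of_le h.le) (ih p hp).1,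
        Finset.sdiff_subset_sdiff subset_rfl (U_subset_of_le h.le) (ih p hp).2⟩

theorem exists_mem_labels
    (hlam : ∀ ⦃M' M : LPM n⦄ (h : M' ⋖ M),
      AddsGoodPair M' M (OrderDual.ofDual (lam h)).1 (OrderDual.ofDual (lam h)).2)
    {x y : LPM n} (C : SaturatedChain x y) :
    (∀ l ∈ y.L \ x.L, ∃ p ∈ C.labels lam, ((OrderDual.ofDual p).1 : ℕ) = l) ∧
      ∀ u ∈ y.U \ x.U, ∃ p ∈ C.labels lam, ((OrderDual.ofDual p).2 : ℕ) = u := by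
  induction C with
  | nil => simp
  | @cons x z y h C ih =>
    refine ⟨fun l hl => ?_, fun u hu => ?_⟩
    · rw [Finset.mem_sdiff] at hl
      by_cases hz : l ∈ z.L
      · have : l ∈ z.L \ x.L := Finset.mem_sdiff.2 ⟨hz, hl.2⟩
        rw [(hlam h).L_sdiff, Finset.mem_singleton] at this
        exact ⟨lam h, List.mem_cons_self, this.symm⟩
      · obtain ⟨p, hp, hpl⟩ := ih.1 l (Finset.mem_sdiff.2 ⟨hl.1, hz⟩)
        exact ⟨p, List.mem_cons_of_mem _ hp, hpl⟩
    · rw [Finset.mem_sdiff] at hu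
      by_cases hz : u ∈ z.U
      · have : u ∈ z.U \ x.U := Finset.mem_sdiff.2 ⟨hz, hu.2⟩
        rw [(hlam h).U_sdiff, Finset.mem_singleton] at this
        exact ⟨lam h, List.mem_cons_self, this.symm⟩
      · obtain ⟨p, hp, hpu⟩ := ih.2 u (Finset.mem_sdiff.2 ⟨hu.1, hz⟩)
        exact ⟨p, List.mem_cons_of_mem _ hp, hpu⟩

/-- Induction on the rank difference. The increasing chain starts with the pair `(l, u)` of the two
maxima and continues with the increasing chain of the remaining interval. -/
theorem isELLabeling
    (hlam : ∀ ⦃M' M : LPM n⦄ (h : M' ⋖ M),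
      AddsGoodPair M' M (OrderDual.ofDual (lam h)).1 (OrderDual.ofDual (lam h)).2) :
    IsELLabeling lam := by
  have nil_unique : ∀ {x y : LPM n} (C : SaturatedChain x y) (h : x = y),
      C = h ▸ SaturatedChain.nil x := by
    intro x y C h
    cases C with
    | nil => rfl
    | cons h1 C1 => exact absurd (C1.le.trans h.ge) h1.lt.not_ge
  suffices H : ∀ (k : ℕ) (x y : LPM n), x ≤ y → y.U.card ≤ x.U.card + k →
      ∃ C : SaturatedChain x y, (C.labels lam).Pairwise (· ≤ ·) ∧
        (∀ C' : SaturatedChain x y, (C'.labels lam).Pairwise (· ≤ ·) → C' = C) ∧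
        ∀ C' : SaturatedChain x y, C' ≠ C → List.Lex (· < ·) (C.labels lam) (C'.labels lam) from
    fun x y hxy => H y.U.card x y hxy (by omega)
  intro k
  induction k with
  | zero =>
    intro x y hxy hk
    obtain rfl : x = y := eq_of_card_U_le (U_subset_of_le hxy) (L_subset_of_le hxy) (by omega)
    exact ⟨.nil x, List.Pairwise.nil, fun C' _ => nil_unique C' rfl,
      fun C' h => absurd (nil_unique C' rfl) h⟩
  | succ k ih =>
    intro x y hxy hk
    rcases eq_or_lt_of_le hxy with rfl | hlt
    · exact ⟨.nil x, List.Pairwise.nil, fun C' _ => nil_unique C' rfl,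
        fun C' h => absurd (nil_unique C' rfl) h⟩
    obtain ⟨z, l, u, hz, hzy, hlmax, humax⟩ := exists_isMaxAdd hlt
    have hcard := hz.card_eq
    obtain ⟨C, hC, hCu, hCl⟩ := ih z y hzy (by omega)
    have hlamz := (hlam hz.covBy).labels_unique hz
    refine ⟨.cons hz.covBy C, ?_, ?_, ?_⟩
    · rw [SaturatedChain.labels, List.pairwise_cons]
      refine ⟨fun p hp => ?_, hC⟩
      have := mem_sdiff_of_mem_labels hlam (.cons hz.covBy C) p (List.mem_cons_of_mem _ hp)
      have h1 := hlmax _ this.1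
      have h2 := humax _ this.2
      rw [← hlamz.1] at h1
      rw [← hlamz.2] at h2
      exact ⟨h1, h2⟩
    · intro C' hC'
      cases C' with
      | nil => exact absurd hlt (lt_irrefl _)
      | @cons _ z' _ h C1 =>
        rw [SaturatedChain.labels, List.pairwise_cons] at hC'
        have hmax : ∀ p ∈ (SaturatedChain.cons h C1).labels lam, lam h ≤ p := by
          intro p hp
          rw [SaturatedChain.labels, List.mem_cons] at hp
          rcases hp with rfl | hp
          · exact le_rfl
          · exact hC'.1 p hp
        -- The maxima `l` and `u` occur in labels of this chain, possibly two different ones. The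
        -- first label of an increasing chain is componentwise at least as large as both, hence
        -- equals `(l, u)`.
        obtain ⟨e1, e2⟩ := exists_mem_labels hlam (.cons h C1)
        obtain ⟨p1, hp1, hl1⟩ := e1 l (hz.mem_L_sdiff hzy)
        obtain ⟨p2, hp2, hl2⟩ := e2 u (hz.mem_U_sdiff hzy)
        have a1 : ((OrderDual.ofDual p1).1 : ℕ) ≤ (OrderDual.ofDual (lam h)).1 := (hmax p1 hp1).1
        have a2 : ((OrderDual.ofDual p2).2 : ℕ) ≤ (OrderDual.ofDual (lam h)).2 := (hmax p2 hp2).2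
        have a3 := hlmax _ ((hlam h).mem_L_sdiff C1.le)
        have a4 := humax _ ((hlam h).mem_U_sdiff C1.le)
        have hh := hlam h
        rw [show ((OrderDual.ofDual (lam h)).1 : ℕ) = l by omega,
          show ((OrderDual.ofDual (lam h)).2 : ℕ) = u by omega] at hh
        obtain rfl := hh.unique hz
        rw [hCu C1 hC'.2]
    · intro C' hC'
      cases C' with
      | nil => exact absurd hlt (lt_irrefl _)
      | @cons _ z' _ h C1 =>
        rw [SaturatedChain.labels, SaturatedChain.labels]
        by_cases hzz : z' = z
        · subst hzz
          exact List.Lex.cons (hCl C1 fun hCC => hC' (by rw [hCC]))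
        -- The label with the componentwise largest entries is the smallest in the reversed order,
        -- and equal labels would give equal covers.
        · refine List.Lex.rel (lt_of_le_of_ne ?_ fun heq => hzz ?_)
          · have h1 := hlmax _ ((hlam h).mem_L_sdiff C1.le)
            have h2 := humax _ ((hlam h).mem_U_sdiff C1.le)
            rw [← hlamz.1] at h1
            rw [← hlamz.2] at h2
            exact ⟨h1, h2⟩
          · have hh := hlam h
            rw [← heq] at hh
            exact hh.unique (hlam hz.covBy)

end LPM

/-! ## Shellability of order complexes -/

section Shelling

variable {P : Type*} [PartialOrder P]

/-- Among the upper covers of `x` in `[x, y]`, the cover `z` has strictly smallest weight. -/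
def IsFirstStep (w : P → P → ℤ) (x z y : P) : Prop :=
  x ⋖ z ∧ z ≤ y ∧ ∀ z', x ⋖ z' → z' ≤ y → z' ≠ z → w x z < w x z'

theorem IsFirstStep.unique {w : P → P → ℤ} {x y z z' : P} (h : IsFirstStep w x z y)
    (h' : IsFirstStep w x z' y) : z = z' := by
  by_contra hne
  exact lt_asymm (h.2.2 z' h'.1 h'.2.1 (Ne.symm hne)) (h'.2.2 z h.1 h.2.1 hne)

/-- A weighting of the covers of a ranked poset whose lexicographically first chains can be recognized
locally. -/
structure IsLexWeight (w : P → P → ℤ) (ρ : P → ℕ) : Prop where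
  strictMono : StrictMono ρ
  rank_covBy : ∀ ⦃x y⦄, x ⋖ y → ρ y = ρ x + 1
  exists_first : ∀ ⦃x y⦄, x < y → ∃ z, IsFirstStep w x z y
  first_trans : ∀ ⦃x z z' y⦄, IsFirstStep w x z z' → IsFirstStep w z z' y → IsFirstStep w x z y

theorem mem_of_maximal_face {s : Finset P} (hs : Maximal (· ∈ (orderComplex P).faces) s) {t : P}
    (ht : ∀ y ∈ s, t ≤ y ∨ y ≤ t) : t ∈ s := by
  classical
  have hins : insert t s ∈ (orderComplex P).faces := by
    refine ⟨Finset.insert_nonempty _ _, ?_⟩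
    rw [Finset.coe_insert]
    exact hs.prop.2.insert fun y hy _ => ht y hy
  exact hs.le_of_ge hins (Finset.subset_insert t s) (Finset.mem_insert_self t s)

/-- The first `r + 1` terms of `c` form a saturated chain from `a` to `b`. -/
structure IsSaturatedSeq (a b : P) (r : ℕ) (c : ℕ → P) : Prop where
  zero : c 0 = a
  last : c r = b
  covBy : ∀ i < r, c i ⋖ c (i + 1)

open Classical in
/-- The set of the first `r + 1` terms of `c`. -/
noncomputable def facet (r : ℕ) (c : ℕ → P) : Finset P := (Finset.range (r + 1)).image c

theorem mem_facet {P : Type*} {r : ℕ} {c : ℕ → P} {x : P} :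
    x ∈ facet r c ↔ ∃ i ≤ r, c i = x := by
  simp [facet]

/-- The sequence of weights along a chain, ordered lexicographically. -/
def weightSeq (w : P → P → ℤ) (r : ℕ) (c : ℕ → P) : Lex (Fin r → ℤ) :=
  toLex fun i => w (c i) (c (i + 1))

namespace IsSaturatedSeq

variable {a b : P} {r : ℕ} {c d : ℕ → P}

theorem mono (hc : IsSaturatedSeq a b r c) {i j : ℕ} (hij : i ≤ j) (hj : j ≤ r) : c i ≤ c j := by
  induction j, hij using Nat.le_induction with
  | base => exact le_rfl
  | succ j _ ih => exact (ih (by omega)).trans (hc.covBy j (by omega)).le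

theorem rank (hc : IsSaturatedSeq a b r c) {ρ : P → ℕ} (hρ : ∀ ⦃x y⦄, x ⋖ y → ρ y = ρ x + 1)
    (h0 : ρ a = 0) {i : ℕ} (hi : i ≤ r) : ρ (c i) = i := by
  induction i with
  | zero => rw [hc.zero, h0]
  | succ i ih => rw [hρ (hc.covBy i (by omega)), ih (by omega)]

theorem maximal_facet (hc : IsSaturatedSeq a b r c) (ha : ∀ x, a ≤ x) (hb : ∀ x, x ≤ b) :
    Maximal (· ∈ (orderComplex P).faces) (facet r c) := by
  refine ⟨⟨⟨c 0, mem_facet.2 ⟨0, Nat.zero_le _, rfl⟩⟩, ?_⟩, fun s hs hcs x hx => ?_⟩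
  · intro x hx y hy _
    obtain ⟨i, hi, rfl⟩ := mem_facet.1 hx
    obtain ⟨j, hj, rfl⟩ := mem_facet.1 hy
    rcases le_total i j with h | h
    · exact Or.inl (hc.mono h hj)
    · exact Or.inr (hc.mono h hi)
  · classical
    have h0 : c 0 ≤ x := hc.zero ▸ ha x
    set i := Nat.findGreatest (fun i => c i ≤ x) r with hi
    have hir : i ≤ r := Nat.findGreatest_le r
    have hix : c i ≤ x := Nat.findGreatest_spec (P := fun i => c i ≤ x) (Nat.zero_le r) h0
    refine mem_facet.2 ⟨i, hir, ?_⟩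
    rcases hir.eq_or_lt with hir | hir
    · refine hix.antisymm ?_
      rw [hir, hc.last]
      exact hb x
    · have hnot : ¬ c (i + 1) ≤ x :=
        Nat.findGreatest_is_greatest (P := fun i => c i ≤ x) (n := r) (Nat.lt_succ_self i) hir
      by_contra hne
      have hmem : c (i + 1) ∈ s := hcs (mem_facet.2 ⟨i + 1, hir, rfl⟩)
      have hlt : x < c (i + 1) := by
        rcases hs.2.total hmem hx with h | h
        · exact absurd h hnot
        · exact lt_of_le_of_ne h fun h' => hnot h'.ge
      exact (hc.covBy i hir).2 (lt_of_le_of_ne hix hne) hlt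

variable {ρ : P → ℕ}

theorem eq_of_mem_facet (hc : IsSaturatedSeq a b r c) (hρ : ∀ ⦃x y⦄, x ⋖ y → ρ y = ρ x + 1)
    (h0 : ρ a = 0) {x : P} (hx : x ∈ facet r c) : c (ρ x) = x := by
  obtain ⟨i, hi, rfl⟩ := mem_facet.1 hx
  rw [hc.rank hρ h0 hi]

theorem card_facet (hc : IsSaturatedSeq a b r c) (hρ : ∀ ⦃x y⦄, x ⋖ y → ρ y = ρ x + 1)
    (h0 : ρ a = 0) : (facet r c).card = r + 1 := by
  classical
  rw [facet, Finset.card_image_of_injOn, Finset.card_range]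
  intro i hi j hj hij
  have hi' : i < r + 1 := by simpa using hi
  have hj' : j < r + 1 := by simpa using hj
  rw [← hc.rank hρ h0 (i := i) (by omega), ← hc.rank hρ h0 (i := j) (by omega), hij]

theorem eq_of_facet_eq (hc : IsSaturatedSeq a b r c) (hd : IsSaturatedSeq a b r d)
    (hρ : ∀ ⦃x y⦄, x ⋖ y → ρ y = ρ x + 1) (h0 : ρ a = 0) (h : facet r c = facet r d) {i : ℕ}
    (hi : i ≤ r) : c i = d i := by
  have := hd.eq_of_mem_facet hρ h0 (h ▸ mem_facet.2 ⟨i, hi, rfl⟩ : c i ∈ facet r d)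
  rw [hc.rank hρ h0 hi] at this
  exact this.symm

end IsSaturatedSeq

theorem exists_isSaturatedSeq_of_maximal {a b : P} (ha : ∀ x, a ≤ x) (hb : ∀ x, x ≤ b) {ρ : P → ℕ}
    (hmono : StrictMono ρ) (hρ : ∀ ⦃x y⦄, x ⋖ y → ρ y = ρ x + 1) (h0 : ρ a = 0) {s : Finset P}
    (hs : Maximal (· ∈ (orderComplex P).faces) s) :
    ∃ c, IsSaturatedSeq a b (ρ b) c ∧ s = facet (ρ b) c := by
  classical
  have has : a ∈ s := mem_of_maximal_face hs fun y _ => Or.inl (ha y)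
  have hbs : b ∈ s := mem_of_maximal_face hs fun y _ => Or.inr (hb y)
  have next : ∀ x ∈ s, x ≠ b → ∃ z ∈ s, x ⋖ z := by
    intro x hx hxb
    -- The successor of `x` in the chain is the element of least rank above it; maximality of `s`
    -- makes it a cover.
    obtain ⟨z, hz, hmin⟩ := Finset.exists_min_image (s.filter (x < ·)) ρ
      ⟨b, Finset.mem_filter.2 ⟨hbs, lt_of_le_of_ne (hb x) hxb⟩⟩
    rw [Finset.mem_filter] at hz
    have hzle : ∀ y ∈ s, x < y → z ≤ y := fun y hy hxy => by
      rcases hs.prop.2.total hz.1 hy with h | h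
      · exact h
      · rcases h.eq_or_lt with h | h
        · exact h.ge
        · exact absurd (hmin y (Finset.mem_filter.2 ⟨hy, hxy⟩)) (not_le.2 (hmono h))
    refine ⟨z, hz.1, hz.2, fun t hxt htz => ?_⟩
    have hts : t ∈ s := mem_of_maximal_face hs fun y hy => by
      rcases hs.prop.2.total hx hy with h | h
      · rcases h.eq_or_lt with h | h
        · exact Or.inr (h ▸ hxt.le)
        · exact Or.inl (htz.le.trans (hzle y hy h))
      · exact Or.inr (h.trans hxt.le)
    exact (hzle t hts hxt).not_gt htz
  choose! f hfs hf using next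
  let c : ℕ → P := fun i => f^[i] a
  have hsucc : ∀ i, c (i + 1) = f (c i) := fun i => Function.iterate_succ_apply' f i a
  have key : ∀ i ≤ ρ b, c i ∈ s ∧ ρ (c i) = i := by
    intro i
    induction i with
    | zero => exact fun _ => ⟨has, h0⟩
    | succ i ih =>
      intro hi
      obtain ⟨h1, h2⟩ := ih (by omega)
      have hne : c i ≠ b := fun h => by rw [h] at h2; omega
      rw [hsucc]
      exact ⟨hfs _ h1 hne, by rw [hρ (hf _ h1 hne), h2]⟩
  have hc : IsSaturatedSeq a b (ρ b) c := by
    refine ⟨rfl, ?_, fun i hi => ?_⟩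
    · by_contra hne
      have := hmono (lt_of_le_of_ne (hb (c (ρ b))) hne)
      rw [(key _ le_rfl).2] at this
      exact lt_irrefl _ this
    · obtain ⟨h1, h2⟩ := key i hi.le
      rw [hsucc]
      exact hf _ h1 fun h => by rw [h] at h2; omega
  refine ⟨c, hc, ((hc.maximal_facet ha hb).eq_of_le hs.prop fun x hx => ?_).symm⟩
  obtain ⟨i, hi, rfl⟩ := mem_facet.1 hx
  exact (key i hi).1

/-- A chain that goes locally along first steps starts with a first step. -/
theorem IsLexWeight.isFirstStep_of_local {w : P → P → ℤ} {ρ : P → ℕ} (hw : IsLexWeight w ρ)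
    {c : ℕ → P} {i g : ℕ} (hig : i < g) (hc : ∀ e, i ≤ e → e < g → c e ⋖ c (e + 1))
    (hloc : ∀ e, i ≤ e → e + 1 < g → IsFirstStep w (c e) (c (e + 1)) (c (e + 2))) :
    IsFirstStep w (c i) (c (i + 1)) (c g) := by
  obtain ⟨k, rfl⟩ := Nat.exists_eq_add_of_lt hig
  induction k generalizing i with
  | zero =>
    obtain ⟨z, hz⟩ := hw.exists_first (hc i le_rfl hig).lt
    have : z = c (i + 1) :=
      hz.2.1.eq_of_not_lt fun h => (hc i le_rfl hig).2 hz.1.lt h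
    exact this ▸ hz
  | succ k ih =>
    have h1 := @ih (i + 1) (by omega) (fun e h1 h2 => hc e (by omega) (by omega))
      (fun e h1 h2 => hloc e (by omega) (by omega))
    rw [show i + 1 + k + 1 = i + (k + 1) + 1 by omega] at h1
    exact hw.first_trans (hloc i le_rfl (by omega)) h1

open Classical in
-- Let `c` and `d` separate after position `m` and meet again at `g`. Since `d` does not come after
-- `c`, somewhere strictly between `m` and `g` the chain `c` fails to be locally first. Replacing
-- that one element by the first step lowers the weight sequence and loses nothing of `c ∩ d`.
-- Equality of the weight sequences of `c` and `d` is allowed.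
theorem IsLexWeight.exists_lt_weightSeq {w : P → P → ℤ} {ρ : P → ℕ} (hw : IsLexWeight w ρ) {a b : P}
    (h0 : ρ a = 0) {r : ℕ} {c d : ℕ → P} (hc : IsSaturatedSeq a b r c)
    (hd : IsSaturatedSeq a b r d) (hne : facet r c ≠ facet r d)
    (hle : weightSeq w r d ≤ weightSeq w r c) :
    ∃ c', IsSaturatedSeq a b r c' ∧ weightSeq w r c' < weightSeq w r c ∧
      facet r d ∩ facet r c ⊆ facet r c' ∧ (facet r c ∩ facet r c').card = r := by
  have hex : ∃ i, i ≤ r ∧ c i ≠ d i := by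
    by_contra! h
    exact hne (Finset.image_congr fun i hi => h i (by simpa [Nat.lt_succ_iff] using hi))
  obtain ⟨hmr, hm⟩ := Nat.find_spec hex
  have hmin : ∀ i < Nat.find hex, c i = d i := fun i hi => by
    by_contra h
    exact Nat.find_min hex hi ⟨by omega, h⟩
  generalize Nat.find hex = m at hmr hm hmin
  have hm0 : m ≠ 0 := fun h => hm (by rw [h, hc.zero, hd.zero])
  obtain ⟨m, rfl⟩ : ∃ k, m = k + 1 := ⟨m - 1, by omega⟩
  have hex2 : ∃ g, m + 1 < g ∧ c g = d g := by
    refine ⟨r, lt_of_le_of_ne hmr fun h => hm ?_, by rw [hc.last, hd.last]⟩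
    rw [h, hc.last, hd.last]
  have hgr : Nat.find hex2 ≤ r := Nat.find_min' hex2
    ⟨lt_of_le_of_ne hmr fun h => hm (by rw [h, hc.last, hd.last]), by rw [hc.last, hd.last]⟩
  obtain ⟨hmg, hg⟩ := Nat.find_spec hex2
  have hgmin : ∀ i, m < i → i < Nat.find hex2 → c i ≠ d i := fun i h1 h2 h3 => by
    rcases (show m + 1 ≤ i by omega).eq_or_lt with h | h
    · exact hm (h ▸ h3)
    · exact Nat.find_min hex2 h2 ⟨h, h3⟩
  generalize Nat.find hex2 = g at hgr hmg hg hgmin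
  -- a position where `c` does not go along the first step
  obtain ⟨e, hme, heg, he⟩ : ∃ e, m ≤ e ∧ e + 1 < g ∧
      ¬ IsFirstStep w (c e) (c (e + 1)) (c (e + 2)) := by
    by_contra! hloc
    -- Otherwise `c` would leave `c m` by the strictly cheapest cover below `c g = d g`, beating the
    -- step of `d` there.
    have hfirst := hw.isFirstStep_of_local (show m < g by omega)
      (fun e _ h2 => hc.covBy e (by omega)) hloc
    refine absurd hle (not_le.2 ⟨⟨m, by omega⟩, fun j hj => ?_, ?_⟩)
    · have hj' : (j : ℕ) < m := hj
      change w (c j) (c (j + 1)) = w (d j) (d (j + 1))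
      rw [hmin j (by omega), hmin (j + 1) (by omega)]
    · change w (c m) (c (m + 1)) < w (d m) (d (m + 1))
      rw [← hmin m (by omega)]
      refine hfirst.2.2 _ ?_ ?_ (Ne.symm hm)
      · rw [hmin m (by omega)]
        exact hd.covBy m (by omega)
      · rw [hg]
        exact hd.mono (by omega) hgr
  have hce := hc.covBy e (by omega)
  have hce' := hc.covBy (e + 1) (by omega)
  obtain ⟨z, hz⟩ := hw.exists_first (hce.lt.trans hce'.lt)
  have hzne : c (e + 1) ≠ z := fun h => he (h ▸ hz)
  have hrz := hw.rank_covBy hz.1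
  have hrc := hw.rank_covBy hce
  have hrc' := hw.rank_covBy hce'
  -- Ranks leave no room between `z` and `c (e + 2)`.
  have hz2 : z ⋖ c (e + 2) := by
    refine ⟨lt_of_le_of_ne hz.2.1 fun h => ?_, fun t h1 h2 => ?_⟩
    · rw [h] at hrz
      change ρ (c (e + 2)) = _ at hrc'
      omega
    · have := hw.strictMono h1
      have := hw.strictMono h2
      change ρ (c (e + 2)) = _ at hrc'
      omega
  let c' : ℕ → P := Function.update c (e + 1) z
  have hc'e : c' (e + 1) = z := Function.update_self _ _ _
  have hc'ne : ∀ i, i ≠ e + 1 → c' i = c i := fun i hi => Function.update_of_ne hi _ _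
  have hc' : IsSaturatedSeq a b r c' := by
    refine ⟨?_, ?_, fun i hi => ?_⟩
    · rw [hc'ne 0 (by omega), hc.zero]
    · rw [hc'ne r (by omega), hc.last]
    · by_cases h1 : i = e
      · subst h1
        rw [hc'ne i (by omega), hc'e]
        exact hz.1
      · by_cases h2 : i = e + 1
        · subst h2
          rw [hc'ne (e + 1 + 1) (by omega), hc'e]
          exact hz2
        · rw [hc'ne i h2, hc'ne (i + 1) (by omega)]
          exact hc.covBy i hi
  have hinter : facet r c ∩ facet r c' = (facet r c).erase (c (e + 1)) := by
    ext x
    rw [Finset.mem_inter, Finset.mem_erase, and_comm (a := x ≠ _)]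
    refine and_congr_right fun hx => ⟨?_, fun hxe => ?_⟩
    · rintro hx' rfl
      have h1 := hc'.eq_of_mem_facet hw.rank_covBy h0 hx'
      rw [hc.rank hw.rank_covBy h0 (by omega), hc'e] at h1
      exact hzne h1.symm
    · obtain ⟨i, hi, rfl⟩ := mem_facet.1 hx
      exact mem_facet.2 ⟨i, hi, hc'ne i fun h => hxe (by rw [h])⟩
  refine ⟨c', hc', ⟨⟨e, by omega⟩, fun j hj => ?_, ?_⟩, fun x hx => ?_, ?_⟩
  · have hj' : (j : ℕ) < e := hj
    change w (c' j) (c' (j + 1)) = w (c j) (c (j + 1))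
    rw [hc'ne j (by omega), hc'ne (j + 1) (by omega)]
  · change w (c' e) (c' (e + 1)) < w (c e) (c (e + 1))
    rw [hc'ne e (by omega), hc'e]
    exact hz.2.2 _ hce hce'.le hzne
  · rw [Finset.mem_inter] at hx
    refine (Finset.mem_inter.1 (hinter ▸ Finset.mem_erase.2 ⟨?_, hx.2⟩ :
      x ∈ facet r c ∩ facet r c')).2
    rintro rfl
    -- By rank, `d` could contain `c (e + 1)` only at position `e + 1`, where the two chains differ.
    have h1 := hd.eq_of_mem_facet hw.rank_covBy h0 hx.1
    rw [hc.rank hw.rank_covBy h0 (by omega)] at h1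
    exact hgmin (e + 1) (by omega) heg h1.symm
  · rw [hinter, Finset.card_erase_of_mem (mem_facet.2 ⟨e + 1, by omega, rfl⟩),
      hc.card_facet hw.rank_covBy h0, Nat.add_sub_cancel]

/-- Sort the maximal chains by weight sequence, breaking ties arbitrarily. For `i < j` the exchange
gives an earlier `F k` with `F i ∩ F j ⊆ F j ∩ F k` and `F j ∩ F k` of codimension one in `F j`; a
strict decrease of weight guarantees `k < j` whatever the ties. -/
theorem IsLexWeight.isShellable [Finite P] {w : P → P → ℤ} {ρ : P → ℕ} (hw : IsLexWeight w ρ)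
    {a b : P} (ha : ∀ x, a ≤ x) (hb : ∀ x, x ≤ b) (h0 : ρ a = 0) :
    IsShellable (orderComplex P) := by
  classical
  have hρ := hw.rank_covBy
  let T := {s : Finset P // Maximal (· ∈ (orderComplex P).faces) s}
  have hT : ∀ s : T, ∃ c, IsSaturatedSeq a b (ρ b) c ∧ s.1 = facet (ρ b) c := fun s =>
    exists_isSaturatedSeq_of_maximal ha hb hw.strictMono hρ h0 s.2
  choose c hc hcs using hT
  obtain ⟨t, ⟨e⟩⟩ := Finite.exists_equiv_fin T
  let key : Fin t → Lex (Fin (ρ b) → ℤ) := fun j => weightSeq w (ρ b) (c (e.symm j))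
  let σ := Tuple.sort key
  have hσ : Monotone (key ∘ σ) := Tuple.monotone_sort key
  refine ⟨Set.toFinite _, ρ b, t, fun j => (e.symm (σ j)).1, ?_, fun s => ?_, fun j => ?_,
    fun j _ G hG => ?_⟩
  · exact Subtype.val_injective.comp (e.symm.injective.comp σ.injective)
  · constructor
    · rintro ⟨j, rfl⟩
      exact (e.symm (σ j)).2
    · exact fun hs => ⟨σ.symm (e ⟨s, hs⟩), by simp⟩
  · simp only
    rw [hcs, (hc _).card_facet hρ h0]
  · obtain ⟨⟨hGj, i, hij, hGi⟩, hmax⟩ := hG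
    simp only at hGj hGi
    have hne : facet (ρ b) (c (e.symm (σ j))) ≠ facet (ρ b) (c (e.symm (σ i))) := fun h => by
      rw [← hcs, ← hcs] at h
      exact hij.ne (σ.injective (e.symm.injective (Subtype.val_injective h.symm)))
    obtain ⟨c', hc', hlt, hsub, hcard⟩ := hw.exists_lt_weightSeq h0 (hc _) (hc _) hne (hσ hij.le)
    let s' : T := ⟨facet (ρ b) c', hc'.maximal_facet ha hb⟩
    let k := σ.symm (e s')
    have hk : e.symm (σ k) = s' := by simp [k]
    have hkey : key (σ k) = weightSeq w (ρ b) c' := by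
      simp only [key, hk, weightSeq]
      congr 1
      funext m
      have hm := m.2
      have hfac : facet (ρ b) (c s') = facet (ρ b) c' := (hcs s').symm
      rw [(hc s').eq_of_facet_eq hc' hρ h0 hfac (by omega),
        (hc s').eq_of_facet_eq hc' hρ h0 hfac (by omega)]
    have hkj : k < j := by
      by_contra! hjk
      have hle : key (σ j) ≤ key (σ k) := hσ hjk
      rw [hkey] at hle
      exact not_lt.2 hle hlt
    have hGle : G ⊆ facet (ρ b) (c (e.symm (σ j))) ∩ facet (ρ b) c' := by
      refine Finset.subset_inter (hcs _ ▸ hGj) (Finset.Subset.trans ?_ hsub)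
      exact Finset.subset_inter (hcs _ ▸ hGi) (hcs _ ▸ hGj)
    have hGeq := hmax (y := facet (ρ b) (c (e.symm (σ j))) ∩ facet (ρ b) c')
      ⟨by simp only [hcs (e.symm (σ j))]; exact Finset.inter_subset_left, k, hkj, by
        simp only [hk]; exact Finset.inter_subset_right⟩ hGle
    rw [← hcard]
    exact congrArg Finset.card (hGle.antisymm hGeq)

end Shelling

/-- A lexicographic weighting restricts to intervals. -/
theorem IsLexWeight.subtype_Icc {P : Type*} [PartialOrder P] {w : P → P → ℤ} {ρ : P → ℕ}
    (hw : IsLexWeight w ρ) (a b : P) :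
    IsLexWeight (fun x y : Set.Icc a b => w x y) (fun x => ρ x - ρ a) := by
  have hcov : ∀ x y : Set.Icc a b, x ⋖ y ↔ (x : P) ⋖ y := fun x y =>
    (Set.OrdConnected.apply_covBy_apply_iff (OrderEmbedding.subtype (· ∈ Set.Icc a b))
      (by
        change (Set.range (Subtype.val : Set.Icc a b → P)).OrdConnected
        rw [Subtype.range_coe]
        exact Set.ordConnected_Icc)).symm
  have hfirst : ∀ x z y : Set.Icc a b,
      IsFirstStep (fun x y : Set.Icc a b => w x y) x z y ↔ IsFirstStep w (x : P) z y := by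
    intro x z y
    unfold IsFirstStep
    rw [hcov]
    refine and_congr_right fun hxz => and_congr Iff.rfl ⟨fun h z' h1 h2 h3 => ?_,
      fun h z' h1 h2 h3 => ?_⟩
    · exact h ⟨z', x.2.1.trans h1.le, h2.trans y.2.2⟩ ((hcov _ _).2 h1) h2
        fun h4 => h3 (congrArg Subtype.val h4)
    · exact h z' ((hcov _ _).1 h1) h2 fun h4 => h3 (Subtype.ext h4)
  -- This makes the truncated subtraction in the shifted rank harmless.
  have hρ : ∀ x : Set.Icc a b, ρ a ≤ ρ x := fun x => hw.strictMono.monotone x.2.1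
  refine ⟨fun x y hxy => ?_, fun x y hxy => ?_, fun x y hxy => ?_, fun x z z' y h1 h2 => ?_⟩
  · have h1 := hw.strictMono (show (x : P) < y from hxy)
    have := hρ x
    omega
  · have h1 := hw.rank_covBy ((hcov x y).1 hxy)
    have := hρ x
    omega
  · obtain ⟨z, hz⟩ := hw.exists_first (show (x : P) < y from hxy)
    exact ⟨⟨z, x.2.1.trans hz.1.le, hz.2.1.trans y.2.2⟩, (hfirst _ _ _).2 hz⟩
  · exact (hfirst _ _ _).2 (hw.first_trans ((hfirst _ _ _).1 h1) ((hfirst _ _ _).1 h2))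

/-! ### The lexicographic weight and the bounds of `𝓟ₙ` -/

namespace LPM

variable {n : ℕ}

/-- The weight of a cover: minus the sum of the two entries of its label. -/
def weight (x y : LPM n) : ℤ :=
  (∑ i ∈ x.L, (i : ℤ) - ∑ i ∈ y.L, (i : ℤ)) + (∑ i ∈ x.U, (i : ℤ) - ∑ i ∈ y.U, (i : ℤ))

theorem AddsGoodPair.weight_eq {x y : LPM n} {l u : ℕ} (h : AddsGoodPair x y l u) :
    weight x y = -(l + u : ℤ) := by
  rw [weight, h.L_eq, h.U_eq, Finset.sum_insert h.notMem_L, Finset.sum_insert h.notMem_U]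
  ring

/-- Both entries are maximal, so a competing label with the same or a larger sum is the same pair
and gives the same cover. -/
theorem IsMaxAdd.isFirstStep {x z y : LPM n} {l u : ℕ} (h : IsMaxAdd x z y l u) :
    IsFirstStep weight x z y := by
  obtain ⟨h, hzy, hl, hu⟩ := h
  refine ⟨h.covBy, hzy, fun z' hz' hz'y hne => ?_⟩
  obtain ⟨l', u', h'⟩ := exists_addsGoodPair hz'
  rw [h.weight_eq, h'.weight_eq]
  have h1 := hl _ (h'.mem_L_sdiff hz'y)
  have h2 := hu _ (h'.mem_U_sdiff hz'y)
  by_contra! hle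
  obtain rfl : l = l' := by omega
  obtain rfl : u = u' := by omega
  exact hne (h'.unique h)

theorem isFirstStep_iff {x z y : LPM n} :
    IsFirstStep weight x z y ↔ ∃ l u, IsMaxAdd x z y l u := by
  refine ⟨fun h => ?_, fun ⟨l, u, h⟩ => h.isFirstStep⟩
  obtain ⟨z', l, u, h'⟩ := exists_isMaxAdd (h.1.lt.trans_le h.2.1)
  exact ⟨l, u, h'.isFirstStep.unique h ▸ h'⟩

/-- For transitivity of first steps: the second pair `(l₂, u₂)` is at most `(l₁, u₁)` by maximality
of the first, and it bounds everything still to be added up to `y`. Hence `(l₁, u₁)` is maximal for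
all of `[x, y]`. -/
theorem isLexWeight_weight : IsLexWeight (weight (n := n)) fun x => x.U.card := by
  refine ⟨fun x y h => card_lt_card_of_lt h, fun x y h => ?_, fun x y h => ?_,
    fun x z z' y h1 h2 => ?_⟩
  · obtain ⟨l, u, h⟩ := exists_addsGoodPair h
    exact h.card_eq
  · obtain ⟨z, l, u, hz⟩ := exists_isMaxAdd h
    exact ⟨z, hz.isFirstStep⟩
  · obtain ⟨l₁, u₁, a₁, hz, hl₁, hu₁⟩ := isFirstStep_iff.1 h1
    obtain ⟨l₂, u₂, a₂, hz', hl₂, hu₂⟩ := isFirstStep_iff.1 h2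
    refine isFirstStep_iff.2 ⟨l₁, u₁, a₁, hz.trans hz', fun i hi => ?_,
      fun i hi => ?_⟩
    · rw [Finset.mem_sdiff] at hi
      have hl : l₂ ≤ l₁ := hl₁ _ (Finset.sdiff_subset_sdiff subset_rfl (L_subset_of_le a₁.le)
        (a₂.mem_L_sdiff le_rfl))
      by_cases hiz : i ∈ z.L
      · rw [a₁.L_eq, Finset.mem_insert] at hiz
        exact (hiz.resolve_right hi.2).le
      · exact (hl₂ _ (Finset.mem_sdiff.2 ⟨hi.1, hiz⟩)).trans hl
    · rw [Finset.mem_sdiff] at hi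
      have hu : u₂ ≤ u₁ := hu₁ _ (Finset.sdiff_subset_sdiff subset_rfl (U_subset_of_le a₁.le)
        (a₂.mem_U_sdiff le_rfl))
      by_cases hiz : i ∈ z.U
      · rw [a₁.U_eq, Finset.mem_insert] at hiz
        exact (hiz.resolve_right hi.2).le
      · exact (hu₂ _ (Finset.mem_sdiff.2 ⟨hi.1, hiz⟩)).trans hu

instance : Finite (LPM n) := by
  refine Finite.of_injective (β := (Finset.Icc 1 n).powerset × (Finset.Icc 1 n).powerset)
    (fun M => (⟨M.U, Finset.mem_powerset.2 M.U_subset⟩, ⟨M.L, Finset.mem_powerset.2 M.L_subset⟩))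
    fun M M' h => ?_
  simp only [Prod.mk.injEq, Subtype.mk.injEq] at h
  exact LPM.ext h.1 h.2

/-- The lattice path matroid of rank `0`. -/
def emptyLPM (n : ℕ) : LPM n := ⟨∅, ∅, by simp, by simp, rfl, fun _ => le_rfl⟩

/-- The free matroid on `[n]`. -/
def fullLPM (n : ℕ) : LPM n := ⟨Finset.Icc 1 n, Finset.Icc 1 n, subset_rfl, subset_rfl, rfl,
  fun _ => le_rfl⟩

theorem emptyLPM_le (M : LPM n) : emptyLPM n ≤ M := by
  have hb : (emptyLPM n).toMatroid.IsBase (∅ : Set ℕ) := by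
    have := ((emptyLPM n).toMatroid_isBase_iff ∅).2 (emptyLPM n).isPathBetween_U
    rwa [Finset.coe_empty] at this
  rw [le_iff_closure_subset]
  intro X
  refine (M.toMatroid.closure_subset_ground X).trans ?_
  refine Set.Subset.trans ?_ ((emptyLPM n).toMatroid.closure_subset_closure (Set.empty_subset X))
  rw [hb.closure_eq]
  exact subset_rfl

theorem le_fullLPM (M : LPM n) : M ≤ fullLPM n := by
  have hb : (fullLPM n).toMatroid.Indep (Set.Icc 1 n) := by
    refine (fullLPM n).isPathBetween_U.indep ?_
    simp [fullLPM]
  rw [le_iff_closure_subset]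
  intro X e he
  have heE : e ∈ Set.Icc 1 n := (fullLPM n).toMatroid.closure_subset_ground X he
  refine M.toMatroid.mem_closure_of_mem' ?_ heE
  by_contra heX
  rw [← Matroid.closure_inter_ground] at he
  refine ((hb.subset Set.inter_subset_right).notMem_closure_iff heE).2 ⟨hb.subset ?_, ?_⟩ he
  · exact Set.insert_subset heE Set.inter_subset_right
  · exact fun h => heX h.1

end LPM

/-- The good pair labeling of the poset `𝓟ₙ` of lattice path matroids on `[n]` is well defined and is
an EL-labeling; hence the order complexes of `𝓟ₙ` and of all its intervals are shellable. -/
theorem theorem3p1 (n : ℕ) :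
    (∃ lam : EdgeLabeling (LPM n) (LabelPoset n), IsGoodPairLabeling lam ∧ IsELLabeling lam) ∧
    IsShellable (orderComplex (LPM n)) ∧
    ∀ x y : LPM n, x ≤ y → IsShellable (orderComplex (Set.Icc x y)) := by
  refine ⟨?_, ?_, fun x y hxy => ?_⟩
  · obtain ⟨lam, hlam⟩ := LPM.exists_isGoodPairLabeling n
    exact ⟨lam, LPM.isGoodPairLabeling_of_addsGoodPair hlam, LPM.isELLabeling hlam⟩
  · exact LPM.isLexWeight_weight.isShellable LPM.emptyLPM_le LPM.le_fullLPM Finset.card_empty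
  · exact (LPM.isLexWeight_weight.subtype_Icc x y).isShellable (a := ⟨x, le_rfl, hxy⟩)
      (b := ⟨y, hxy, le_rfl⟩) (fun z => z.2.1) (fun z => z.2.2) (Nat.sub_self _)
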